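/- **Setting.** Let $D$ be a nearly plat front diagram of a Legendrian link $L\subset\mathbb R^3$: all cusps and crossings have distinct $x$-coordinates, and $D$ is a slight perturbation of a diagram whose left cusps lie on one vertical line, followed by the crossings, followed by the right cusps lying on one vertical line. Strands over a given $x$ are numbered from top to bottom. Each component of $L$ carries exactly one marked point, placed at a right cusp. Let $r(L)$ be the gcd of the rotation numbers of the components, $\mu$ a Maslov potential with values in $\mathbb Z/2r(L)$ (constant along strands, and at every cusp $\mu(\text{upper})=\mu(\text{lower})+1$), and $m\ge 0$ a divisor of $2r(L)$. The degree of a crossing is the difference of $\mu$ on its overstrand and understrand; a crossing is *$m$-graded* if its degree is $0$ mod $m$. Let $\mathbb F$ be a field. **Rulings.** A *normal ruling* $\rho$ assigns to each strip between consecutive cusps/crossings a fixed-point free involution $\sigma$ of the strands, so that strands meeting at a cusp are paired and the other pairs are unchanged at the cusp, and at a crossing of strands $k,k+1$ one has $\sigma(k)\neq k+1$ and either the involution after the crossing is the conjugate of $\sigma$ by $(k\ k{+}1)$, or it equals $\sigma$ (a *switch*) and one of the normality conditions holds: (S1) $\sigma(k)<k<k+1<\sigma(k+1)$; (S2) $\sigma(k+1)<\sigma(k)<k$;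 (S3) $k+1<\sigma(k+1)<\sigma(k)$. A crossing that is not a switch is a *return* if a normality condition holds just after it; its type is, in terms of the involution $\sigma$ before the crossing, (R1) $\sigma(k+1)<k<k+1<\sigma(k)$, (R2) $\sigma(k)<\sigma(k+1)<k$ or (R3) $k+1<\sigma(k)<\sigma(k+1)$. Otherwise it is a *departure*. $\rho$ is *$m$-graded* if all switches are $m$-graded crossings. **Morse complex sequences.** A *handleslide* is a vertical segment between two strands $i<j$, disjoint from crossings and cusps, with a coefficient in $\mathbb F$. An *MCS* $\mathcal C$ for $D$ is a finite collection of handleslides, with distinct $x$-coordinates, and, in each region between consecutive cusps, crossings and handleslides, a differential $d$, $d^2=0$, on the vector space with basis the strands $e_1,e_2,\dots$ of that region, such that $de_i\in\operatorname{span}\{e_j:j>i\}$ and: (i) past a crossing of strands $k,k+1$, interchanging $e_k$ and $e_{k+1}$ is an isomorphism of complexes, and $\langle de_k,e_{k+1}\rangle=0$ next to the crossing; (ii) past a handleslide on strands $i<j$ with coefficient $r$, the map $e_i\mapsto e_i-re_j$ (other $e_l$ fixed) is an isomorphism of complexes; (iii) at a right cusp of strands $k,k+1$, the complex to its right is isomorphic,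 by $e_i\mapsto[e_i]$ for $i<k$ and $e_i\mapsto[e_{i+2}]$ for $i\ge k$, to the quotient of the complex to its left by $\operatorname{span}\{e_k,de_k\}$, and $\langle de_k,e_{k+1}\rangle$ is $-1$ if the cusp is unmarked and is non-zero if it is marked; (iv) at a left cusp the same holds with left and right interchanged, with $\langle de_k,e_{k+1}\rangle=1$. It is *$m$-graded* if every $d$ lowers $\mu$ by $1$ mod $m$ and handleslides join strands with equal $\mu$ mod $m$. A left cusp is *simple* if just after it $de_k=e_{k+1}$ and $\langle de_j,e_k\rangle=\langle de_j,e_{k+1}\rangle=0$ for $j<k$. An MCS with simple left cusps is determined by its handleslides. *SR-form.* For an $m$-graded $\rho$, $MCS^\rho_m(D;\mathbb F)$ is the set of $m$-graded MCSs with simple left cusps whose handleslides are exactly the following. At a switch: one on $k,k+1$ with coefficient $r\ne0$ immediately before, one on $k,k+1$ with coefficient $-r^{-1}$ immediately after, and then, for types (S2), (S3), one on the companion strands $\sigma(k+1)<\sigma(k)$ with coefficient $ar^{-1}b^{-1}$, where $a$ (resp. $b$) is the coefficient of $d$, before these handleslides, joining the two boundary strands of the outer (resp. inner) of the two ruling disks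 that meet at the switch. At an $m$-graded return: one on $k,k+1$ with arbitrary coefficient $r\in\mathbb F$ immediately before and, for types (R2), (R3), one on the companion strands $\sigma(k)<\sigma(k+1)$ immediately after, with coefficient $arb^{-1}$, resp. $a^{-1}rb$, where $a$ (resp. $b$) is the coefficient for the upper (resp. lower) disk. At a right cusp, if $m=1$: one of arbitrary coefficient on the two strands of the cusp, immediately before it. *A-form.* An $m$-graded MCS with simple left cusps is in *A-form* if its handleslides are exactly one, with arbitrary coefficient, immediately to the left of each $m$-graded crossing and, if $m=1$, of each right cusp, on the two strands that meet there. **The map $\Phi$.** Let $\mathcal C\in MCS^\rho_m(D;\mathbb F)$. Two neighbouring handleslides, on $i_1<j_1$ with coefficient $r_1$ (left) and on $i_2<j_2$ with coefficient $r_2$ (right), may be interchanged; if $j_1=i_2$ (resp. $i_1=j_2$), this creates between them a new handleslide on $i_1<j_2$ with coefficient $-r_1r_2$ (resp. on $i_2<j_1$ with coefficient $r_1r_2$). Two neighbouring handleslides with the same endpoints may be merged, adding coefficients; handleslides with coefficient $0$ may be inserted. Working from left to right, carry along a collection $V$, empty before the first crossing, of handleslides, at most one for each pair of strands, ordered from left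 to right by increasing top endpoint and, for equal top endpoints, by decreasing bottom endpoint. At an $m$-graded crossing of strands $k,k+1$: let $h$ be the handleslide of $\mathcal C$ immediately before the crossing (with coefficient $0$ if there is none); move $h$ leftward into its place in $V$ by interchanges and merge it there, merging all newly created handleslides into $V$; then move the handleslide of $V$ on $k,k+1$ leftward out of $V$, again merging newly created ones, and leave it there; slide the rest of $V$ past the crossing, keeping endpoints on the same strands of $D$, and reorder; finally move the handleslides of $\mathcal C$ immediately after the crossing, one after the other, into $V$ in the same way. At other crossings just slide $V$ past the crossing and reorder. After the last crossing erase $V$, except that if $m=1$ each handleslide of $V$ on two strands ending at the same right cusp is slid up to the cusp and merged with the handleslide of $\mathcal C$ there. The handleslides left behind are those of $\Phi(\mathcal C)$. **Proposition.** Let $\rho$ be an $m$-graded normal ruling of $D$, $n(\rho)$ its number of switches, and $r(\rho)$ the number of its $m$-graded returns if $m\ne1$, of its $m$-graded returns and right cusps if $m=1$. Let $q_1,\dots,q_N$ be the crossings and right cusps of $D$, from left to right. For every $\mathcal C\in MCS_m^\rho(D;\mathbb F)$ the handleslides constructed above are those of an A-form MCS $\Phi(\mathcal C)$. For each $1\le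 i\le N$ there is a Laurent polynomial $$g_i^\rho\in\mathbb F[x_1^{\pm1},\dots,x_{n(\rho)}^{\pm1},z_1,\dots,z_{r(\rho)}]$$ such that for every $\mathcal C\in MCS_m^\rho(D;\mathbb F)$ the coefficient of the handleslide at $q_i$ in $\Phi(\mathcal C)$ ($0$ if there is no handleslide at $q_i$) equals $g_i^\rho(r_1,\dots,r_{n(\rho)},u_1,\dots,u_{r(\rho)})$, where $r_j\in\mathbb F^\times$ is the coefficient of the handleslide of $\mathcal C$ immediately to the left of the $j$-th switch, and $u_j\in\mathbb F$ is the coefficient of the handleslide of $\mathcal C$ immediately to the left of the $j$-th $m$-graded return (or right cusp, if $m=1$). -/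

import Mathlib

noncomputable section

/-! ### Front diagrams

A front diagram all of whose cusps and crossings have distinct `x`-coordinates is recorded, up to
planar isotopy, by the sequence of its cusps and crossings read from left to right.  The region
between two consecutive ones is a *gap*: gap `l` lies immediately to the left of the event number
`l` (events are counted from `0`).  In a gap the strands are numbered from top to bottom, starting
with `0`. -/

/-- A cusp or crossing of a front diagram, involving the adjacent strands `k` and `k + 1`. -/
inductive FrontEvent where
  | leftCusp (k : ℕ)
  | crossing (k : ℕ)
  | rightCusp (k : ℕ)

namespace FrontEvent

/-- The number of strands to the right of an event with `s` strands to its left. -/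
def after : FrontEvent → ℕ → ℕ
  | leftCusp _, s => s + 2
  | crossing _, s => s
  | rightCusp _, s => s - 2

/-- The event makes sense when there are `s` strands to its left. -/
def Fits : FrontEvent → ℕ → Prop
  | leftCusp k, s => k ≤ s
  | crossing k, s => k + 1 < s
  | rightCusp k, s => k + 1 < s

end FrontEvent

/-- The number of strands to the right of a sequence of events. -/
def strandCount (w : List FrontEvent) : ℕ := w.foldl (fun s e => e.after s) 0

/-- A front diagram (of a Legendrian link in standard contact `ℝ³`). -/
structure FrontDiagram where
  events : List FrontEvent
  fits : ∀ (l : ℕ) (e : FrontEvent), events[l]? = some e → e.Fits (strandCount (events.take l))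
  closed : strandCount events = 0

/-- The position, after two new strands have been inserted as strands `k` and `k + 1`, of the strand
that used to be strand `i`. -/
def skip (k i : ℕ) : ℕ := if i < k then i else i + 2

namespace FrontDiagram

variable (D : FrontDiagram)

/-- The number of strands in gap `l`. -/
def strands (l : ℕ) : ℕ := strandCount (D.events.take l)

/-- Nearly plat: all left cusps come first and all right cusps come last, and neither the left cusps
nor the right cusps are nested in each other (they are obtained from cusps lying on one vertical
line by a small perturbation). -/
def IsNearlyPlat : Prop :=
  ∃ ls xs rs : List ℕ, D.events =
    ls.map (fun p => FrontEvent.leftCusp (2 * p)) ++ xs.map FrontEvent.crossing ++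
      rs.map (fun p => FrontEvent.rightCusp (2 * p))

/-- `D.Continues (l, i) (l + 1, j)`: strand `i` of gap `l` continues as strand `j` of gap `l + 1`. -/
inductive Continues : ℕ × ℕ → ℕ × ℕ → Prop
  | crossing {l k i : ℕ} : D.events[l]? = some (.crossing k) → i < D.strands l →
      Continues (l, i) (l + 1, Equiv.swap k (k + 1) i)
  | leftCusp {l k i : ℕ} : D.events[l]? = some (.leftCusp k) → i < D.strands l →
      Continues (l, i) (l + 1, skip k i)
  | rightCusp {l k i : ℕ} : D.events[l]? = some (.rightCusp k) → i < D.strands (l + 1) →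
      Continues (l, skip k i) (l + 1, i)

/-- `D.Cusp u v`: `u` and `v` are the upper and the lower strand of a cusp. -/
inductive Cusp : ℕ × ℕ → ℕ × ℕ → Prop
  | left {l k : ℕ} : D.events[l]? = some (.leftCusp k) → Cusp (l + 1, k) (l + 1, k + 1)
  | right {l k : ℕ} : D.events[l]? = some (.rightCusp k) → Cusp (l, k) (l, k + 1)

/-- Two strands belong to the same component of the link. -/
def SameComponent : ℕ × ℕ → ℕ × ℕ → Prop :=
  Relation.EqvGen fun x y => D.Continues x y ∨ D.Cusp x y

/-- An orientation of the link; `1` means that the strand is oriented from left to right. -/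
structure Orientation where
  dir : ℕ × ℕ → ℤˣ
  dir_continues : ∀ x y, D.Continues x y → dir x = dir y
  dir_cusp : ∀ u v, D.Cusp u v → dir u = - dir v

namespace Orientation

variable {D} (o : D.Orientation)

open Classical in
/-- The contribution of event `l` to (number of down cusps) - (number of up cusps) of the component
through the strand `x`. -/
def cuspSign (x : ℕ × ℕ) (l : ℕ) : ℤ :=
  match D.events[l]? with
  | some (.leftCusp k) => if D.SameComponent x (l + 1, k) then -(o.dir (l + 1, k) : ℤ) else 0
  | some (.rightCusp k) => if D.SameComponent x (l, k) then (o.dir (l, k) : ℤ) else 0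
  | _ => 0

/-- Twice the rotation number of the component through the strand `x`. -/
def twoRotOf (x : ℕ × ℕ) : ℤ := ∑ l ∈ Finset.range D.events.length, o.cuspSign x l

/-- Twice the rotation number `r(L)`, the greatest common divisor over all components. -/
def twoRot : ℕ :=
  (Finset.range D.events.length).gcd fun l =>
    (Finset.range (D.strands l)).gcd fun i => (o.twoRotOf (l, i)).natAbs

end Orientation

/-- A Maslov potential with values in `ℤ / M`. -/
structure MaslovPotential (M : ℕ) where
  val : ℕ × ℕ → ZMod M
  val_continues : ∀ x y, D.Continues x y → val x = val y
  val_cusp : ∀ u v, D.Cusp u v → val u = val v + 1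

/-- A choice of one marked point on every component, located at a right cusp.  A right cusp is
referred to by its number in the list of events. -/
structure MarkedPoints where
  cusps : Set ℕ
  rightCusp : ∀ c ∈ cusps, ∃ k : ℕ, D.events[c]? = some (.rightCusp k)
  unique : ∀ l i, i < D.strands l → ∃! c, c ∈ cusps ∧
    ∃ k, D.events[c]? = some (.rightCusp k) ∧ D.SameComponent (l, i) (c, k)

variable {D}

/-- Event `l` is a crossing of degree `0` modulo `m`.  (The overstrand is the strand of smaller
slope, which is strand `k` on the left of the crossing.) -/
def IsGradedCrossing {M : ℕ} (μ : D.MaslovPotential M) (m l : ℕ) : Prop :=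
  ∃ k, D.events[l]? = some (.crossing k) ∧
    ((μ.val (l, k) - μ.val (l, k + 1)).cast : ZMod m) = 0

end FrontDiagram

/-! ### Normal rulings -/

/-- The three configurations, at strands `k` and `k + 1`, of two ruling disks that are disjoint or
nested. Here `σ` is the involution of the ruling. -/
def ConfigS1 (σ : ℕ → ℕ) (k : ℕ) : Prop := σ k < k ∧ k + 1 < σ (k + 1)
def ConfigS2 (σ : ℕ → ℕ) (k : ℕ) : Prop := σ (k + 1) < σ k ∧ σ k < k
def ConfigS3 (σ : ℕ → ℕ) (k : ℕ) : Prop := k + 1 < σ (k + 1) ∧ σ (k + 1) < σ k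

/-- The normality condition. -/
def Normality (σ : ℕ → ℕ) (k : ℕ) : Prop := ConfigS1 σ k ∨ ConfigS2 σ k ∨ ConfigS3 σ k

/-- The configurations of interlaced disks to the left of a return of type (R2) or (R3). -/
def ConfigR2 (σ : ℕ → ℕ) (k : ℕ) : Prop := σ k < σ (k + 1) ∧ σ (k + 1) < k
def ConfigR3 (σ : ℕ → ℕ) (k : ℕ) : Prop := k + 1 < σ k ∧ σ k < σ (k + 1)

/-- A normal ruling; `inv l` is the involution of the strands of gap `l`. -/
structure NormalRuling (D : FrontDiagram) where
  inv : ℕ → ℕ → ℕ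
  inv_lt : ∀ l i, i < D.strands l → inv l i < D.strands l
  inv_inv : ∀ l i, i < D.strands l → inv l (inv l i) = i
  inv_ne : ∀ l i, i < D.strands l → inv l i ≠ i
  leftCusp : ∀ l k, D.events[l]? = some (.leftCusp k) →
    inv (l + 1) k = k + 1 ∧ ∀ i < D.strands l, inv (l + 1) (skip k i) = skip k (inv l i)
  rightCusp : ∀ l k, D.events[l]? = some (.rightCusp k) →
    inv l k = k + 1 ∧ ∀ i < D.strands (l + 1), inv l (skip k i) = skip k (inv (l + 1) i)
  crossing : ∀ l k, D.events[l]? = some (.crossing k) →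
    inv l k ≠ k + 1 ∧
      ((∀ i < D.strands l,
          inv (l + 1) i = Equiv.swap k (k + 1) (inv l (Equiv.swap k (k + 1) i))) ∨
        ((∀ i < D.strands l, inv l i = inv (l + 1) i) ∧ Normality (inv l) k))

namespace NormalRuling

variable {D : FrontDiagram} (ρ : NormalRuling D)

/-- Event `l` is a switch. -/
def IsSwitch (l : ℕ) : Prop :=
  ∃ k, D.events[l]? = some (.crossing k) ∧
    (∀ i < D.strands l, ρ.inv l i = ρ.inv (l + 1) i) ∧ Normality (ρ.inv l) k

/-- Event `l` is a return. -/
def IsReturn (l : ℕ) : Prop :=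
  ∃ k, D.events[l]? = some (.crossing k) ∧ ¬ ρ.IsSwitch l ∧ Normality (ρ.inv (l + 1)) k

variable {M : ℕ} (μ : D.MaslovPotential M) (m : ℕ)

/-- The ruling is `m`-graded. -/
def IsGraded : Prop := ∀ l, ρ.IsSwitch l → D.IsGradedCrossing μ m l

/-- Event `l` is an `m`-graded return. -/
def IsGradedReturn (l : ℕ) : Prop := ρ.IsReturn l ∧ D.IsGradedCrossing μ m l

/-- Event `l` is an `m`-graded return or, if `m = 1`, a right cusp. -/
def IsFree (l : ℕ) : Prop :=
  ρ.IsGradedReturn μ m l ∨ (m = 1 ∧ ∃ k, D.events[l]? = some (.rightCusp k))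

/-- The set of switches, and the set of `m`-graded returns (and right cusps, if `m = 1`); their
cardinalities are `n(ρ)` and `r(ρ)`. -/
abbrev Switches : Type := {l : ℕ // ρ.IsSwitch l}
abbrev FreeEvents : Type := {l : ℕ // ρ.IsFree μ m l}

end NormalRuling

/-! ### Morse complex sequences -/

/-- A handleslide mark between the strands `top < bot`. -/
structure Handleslide (R : Type*) where
  top : ℕ
  bot : ℕ
  coeff : R

section Complexes

variable {R : Type*} [CommRing R]

/-- The basis vector `e_i`. -/
def stdE (R : Type*) [CommRing R] (i : ℕ) : ℕ →₀ R := Finsupp.single i 1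

/-- The matrix coefficient `⟨d e_i, e_j⟩`. -/
def entry (d : Module.End R (ℕ →₀ R)) (i j : ℕ) : R := d (stdE R i) j

/-- `d` is a triangular differential on the free module with basis `e_0, …, e_{s-1}`.  All these
modules are regarded as submodules of `ℕ →₀ R`, and maps are extended by `d e_i = 0` for `s ≤ i`. -/
def IsTriangularDifferential (s : ℕ) (d : Module.End R (ℕ →₀ R)) : Prop :=
  (∀ i j, entry d i j ≠ 0 → i < j ∧ j < s) ∧ d ∘ₗ d = 0

/-- `φ` is an isomorphism of complexes. -/
def IsChainIso (φ d d' : Module.End R (ℕ →₀ R)) : Prop :=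
  Function.Bijective φ ∧ φ ∘ₗ d = d' ∘ₗ φ

/-- Interchanges `e_k` and `e_{k+1}`. -/
def swapMap (R : Type*) [CommRing R] (k : ℕ) : Module.End R (ℕ →₀ R) :=
  Finsupp.lmapDomain R R (Equiv.swap k (k + 1))

/-- `e_i ↦ e_i` for `i < k` and `e_i ↦ e_{i+2}` for `k ≤ i`. -/
def skipMap (R : Type*) [CommRing R] (k : ℕ) : Module.End R (ℕ →₀ R) :=
  Finsupp.lmapDomain R R (skip k)

/-- `e_i ↦ e_i` for `i ≠ h.top` and `e_i ↦ e_i - r e_{h.bot}` for `i = h.top`, with `r = h.coeff`. -/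
def slideMap (h : Handleslide R) : Module.End R (ℕ →₀ R) :=
  LinearMap.id - h.coeff • (Finsupp.lsingle h.bot ∘ₗ Finsupp.lapply h.top)

/-- `e_i ↦ [e_i]` (`i < k`), `e_i ↦ [e_{i+2}]` (`k ≤ i`) is an isomorphism from the complex with
differential `d` to the quotient of the complex with differential `d'` by the subcomplex spanned by
`e_k` and `d' e_k`. -/
def IsCuspIso (k : ℕ) (d d' : Module.End R (ℕ →₀ R)) : Prop :=
  let Q : Submodule R (ℕ →₀ R) := Submodule.span R {stdE R k, d' (stdE R k)}
  Function.Bijective (Q.mkQ ∘ₗ skipMap R k) ∧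
    Q.mkQ ∘ₗ skipMap R k ∘ₗ d = Q.mkQ ∘ₗ d' ∘ₗ skipMap R k

/-- The requirements on the differentials `d` and `d'` to the left and to the right of a crossing or
cusp; `marked` says that the event is a marked right cusp. -/
def EventCondition (marked : Prop) (d d' : Module.End R (ℕ →₀ R)) : FrontEvent → Prop
  | .crossing k => entry d k (k + 1) = 0 ∧ entry d' k (k + 1) = 0 ∧ IsChainIso (swapMap R k) d d'
  | .leftCusp k => entry d' k (k + 1) = 1 ∧ IsCuspIso k d d'
  | .rightCusp k =>
      (marked → IsUnit (entry d k (k + 1))) ∧ (¬ marked → entry d k (k + 1) = -1) ∧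
        IsCuspIso k d' d

end Complexes

/-- A Morse complex sequence over `R`.  The handleslide marks lying in gap `l` form the list
`slides l`, read from left to right, and `d l p` is the differential of the complex in gap `l`
between the first `p` handleslides of that gap and the remaining ones. -/
structure MCS (R : Type*) [CommRing R] (D : FrontDiagram) (pts : D.MarkedPoints) where
  slides : ℕ → List (Handleslide R)
  slides_valid : ∀ l ≤ D.events.length, ∀ h ∈ slides l, h.top < h.bot ∧ h.bot < D.strands l
  d : ℕ → ℕ → Module.End R (ℕ →₀ R)
  differential : ∀ l ≤ D.events.length, ∀ p ≤ (slides l).length,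
    IsTriangularDifferential (D.strands l) (d l p)
  slide_iso : ∀ l ≤ D.events.length, ∀ p h, (slides l)[p]? = some h →
    IsChainIso (slideMap h) (d l p) (d l (p + 1))
  event_condition : ∀ l e, D.events[l]? = some e →
    EventCondition (l ∈ pts.cusps) (d l (slides l).length) (d (l + 1) 0) e

namespace MCS

section General

variable {R : Type*} [CommRing R] {D : FrontDiagram} {pts : D.MarkedPoints} (C : MCS R D pts)

/-- The MCS is `m`-graded. -/
def IsGraded {M : ℕ} (μ : D.MaslovPotential M) (m : ℕ) : Prop :=
  (∀ l ≤ D.events.length, ∀ p ≤ (C.slides l).length, ∀ i j, entry (C.d l p) i j ≠ 0 →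
    ((μ.val (l, j)).cast : ZMod m) = (μ.val (l, i)).cast - 1) ∧
  (∀ l ≤ D.events.length, ∀ h ∈ C.slides l,
    ((μ.val (l, h.top)).cast : ZMod m) = (μ.val (l, h.bot)).cast)

/-- All left cusps are simple. -/
def HasSimpleLeftCusps : Prop :=
  ∀ l k, D.events[l]? = some (.leftCusp k) →
    C.d (l + 1) 0 (stdE R k) = stdE R (k + 1) ∧
      ∀ j < k, entry (C.d (l + 1) 0) j k = 0 ∧ entry (C.d (l + 1) 0) j (k + 1) = 0

/-- The coefficient of the last handleslide to the left of event `l` and to the right of event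
`l - 1` (`0` if there is none). -/
def leftCoeff (l : ℕ) : R :=
  match (C.slides l).getLast? with
  | some h => h.coeff
  | none => 0

/-- The MCS is an `m`-graded MCS in A-form: the handleslides are located immediately to the left of
`m`-graded crossings and, if `m = 1`, of right cusps. -/
structure IsAForm {M : ℕ} (μ : D.MaslovPotential M) (m : ℕ) : Prop where
  graded : C.IsGraded μ m
  simple : C.HasSimpleLeftCusps
  slides_crossing : ∀ l k, D.events[l]? = some (.crossing k) → D.IsGradedCrossing μ m l →
    ∃ r, C.slides l = [⟨k, k + 1, r⟩]
  slides_crossing' : ∀ l k, D.events[l]? = some (.crossing k) → ¬ D.IsGradedCrossing μ m l →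
    C.slides l = []
  slides_rightCusp : ∀ l k, D.events[l]? = some (.rightCusp k) → m = 1 →
    ∃ r, C.slides l = [⟨k, k + 1, r⟩]
  slides_rightCusp' : ∀ l k, D.events[l]? = some (.rightCusp k) → m ≠ 1 → C.slides l = []
  slides_leftCusp : ∀ l k, D.events[l]? = some (.leftCusp k) → C.slides l = []

end General

section SRForm

variable {F : Type*} [Field F] {D : FrontDiagram} {pts : D.MarkedPoints} (C : MCS F D pts)
  (ρ : NormalRuling D) {M : ℕ} (μ : D.MaslovPotential M) (m : ℕ)

open Classical in
/-- The handleslides of an SR-form MCS immediately to the left of event `l`: one handleslide, of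
arbitrary coefficient, between the two strands of a switch, an `m`-graded return or, if `m = 1`, a
right cusp. -/
def preSlides (l : ℕ) : List (Handleslide F) :=
  match D.events[l]? with
  | some (.crossing k) =>
      if ρ.IsSwitch l ∨ ρ.IsGradedReturn μ m l then [⟨k, k + 1, C.leftCoeff l⟩] else []
  | some (.rightCusp k) => if m = 1 then [⟨k, k + 1, C.leftCoeff l⟩] else []
  | _ => []

open Classical in
/-- The handleslides of an SR-form MCS immediately to the right of event `l`.  Here `r` is the
coefficient of the handleslide immediately to the left of a switch or return, and `d` is the
differential just before that handleslide. -/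
def postSlides (l : ℕ) : List (Handleslide F) :=
  let σ := ρ.inv l
  let r := C.leftCoeff l
  let d := C.d l ((C.slides l).length - 1)
  match D.events[l]? with
  | some (.crossing k) =>
      if ρ.IsSwitch l then
        ⟨k, k + 1, -r⁻¹⟩ ::
          (if ConfigS2 σ k then
            -- The outer disk joins `σ (k+1)` and `k+1`, the inner disk joins `σ k` and `k`.
            [⟨σ (k + 1), σ k, entry d (σ (k + 1)) (k + 1) * r⁻¹ * (entry d (σ k) k)⁻¹⟩]
          else if ConfigS3 σ k then
            -- The outer disk joins `k` and `σ k`, the inner disk joins `k+1` and `σ (k+1)`.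
            [⟨σ (k + 1), σ k, entry d k (σ k) * r⁻¹ * (entry d (k + 1) (σ (k + 1)))⁻¹⟩]
          else [])
      else if ρ.IsGradedReturn μ m l then
        (if ConfigR2 σ k then
          -- The upper disk joins `σ k` and `k`, the lower disk joins `σ (k+1)` and `k+1`.
          [⟨σ k, σ (k + 1), entry d (σ k) k * r * (entry d (σ (k + 1)) (k + 1))⁻¹⟩]
        else if ConfigR3 σ k then
          -- The upper disk joins `k` and `σ k`, the lower disk joins `k+1` and `σ (k+1)`.
          [⟨σ k, σ (k + 1), (entry d k (σ k))⁻¹ * r * entry d (k + 1) (σ (k + 1))⟩]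
        else [])
      else []
  | _ => []

/-- The MCS is an `m`-graded MCS in SR-form compatible with the ruling `ρ`. -/
structure IsSRForm : Prop where
  graded : C.IsGraded μ m
  simple : C.HasSimpleLeftCusps
  slides_zero : C.slides 0 = []
  slides_succ : ∀ l < D.events.length,
    C.slides (l + 1) = C.postSlides ρ μ m l ++ C.preSlides ρ μ m (l + 1)
  coeff_ne_zero : ∀ l, ρ.IsSwitch l → C.leftCoeff l ≠ 0

end SRForm

end MCS

/-! ### Moving handleslides

A collection `V` of handleslides is recorded by the list of its members read from *right to left*.
The collections below are such that this list is properly ordered. -/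

section Moves

variable {R : Type*} [CommRing R]

/-- The relation `h ≺ h'` on handleslides. -/
def Handleslide.Prec (h h' : Handleslide R) : Prop :=
  h'.top < h.top ∨ (h.top = h'.top ∧ h.bot < h'.bot)

/-- The two handleslides have the same endpoints. -/
def Handleslide.SameEnds (h h' : Handleslide R) : Prop := h.top = h'.top ∧ h.bot = h'.bot

instance (h h' : Handleslide R) : Decidable (h.Prec h') :=
  inferInstanceAs (Decidable (_ ∨ (_ ∧ _)))

instance (h h' : Handleslide R) : Decidable (h.SameEnds h') :=
  inferInstanceAs (Decidable (_ ∧ _))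

/-- Put `h` at its place in a properly ordered collection, without passing any handleslide with
which it does not commute, and merge it with the handleslide with the same endpoints, if any. -/
def insertSlide (h : Handleslide R) : List (Handleslide R) → List (Handleslide R)
  | [] => [h]
  | g :: V =>
      if h.SameEnds g then ⟨g.top, g.bot, g.coeff + h.coeff⟩ :: V
      else if h.Prec g then h :: g :: V
      else g :: insertSlide h V

/-- The new handleslide, if any, that is created when two neighbouring handleslides `g` (left) and
`h` (right) are interchanged. -/
def interchange (g h : Handleslide R) : List (Handleslide R) :=
  if g.bot = h.top then [⟨g.top, h.bot, -(g.coeff * h.coeff)⟩]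
  else if g.top = h.bot then [⟨h.top, g.bot, g.coeff * h.coeff⟩]
  else []

/-- Incorporate a handleslide `h`, which is to the right of the collection, into the collection: move
it to the left past other handleslides until it reaches its place, where it is merged with the
handleslide with the same endpoints (a trivial one is introduced first, if needed).  A handleslide
created by an interchange is merged into the collection. -/
def incorporate (h : Handleslide R) : List (Handleslide R) → List (Handleslide R)
  | [] => [h]
  | g :: V =>
      if h.SameEnds g then ⟨g.top, g.bot, g.coeff + h.coeff⟩ :: V
      else if h.Prec g then h :: g :: V
      else g :: (interchange g h).foldr insertSlide (incorporate h V)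

/-- The result of moving `h` from the right of the collection `V` to the left of it.  A handleslide
created by an interchange is merged into the collection. -/
def passLeft (h : Handleslide R) : List (Handleslide R) → List (Handleslide R)
  | [] => []
  | g :: V => (interchange g h).foldr insertSlide (g :: passLeft h V)

/-- Remove from a collection its handleslide with endpoints `a` and `b`, to the left. -/
def removeSlide (a b : ℕ) : List (Handleslide R) → List (Handleslide R)
  | [] => []
  | g :: V => if g.top = a ∧ g.bot = b then passLeft g V else g :: removeSlide a b V

/-- The coefficient of the handleslide of the collection with endpoints `a` and `b` (`0` if there is
none). -/
def slideCoeff (a b : ℕ) : List (Handleslide R) → R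
  | [] => 0
  | g :: V => if g.top = a ∧ g.bot = b then g.coeff else slideCoeff a b V

/-- Slide a collection without handleslide between the strands `k` and `k + 1` past a crossing of
these strands, and reorder it. -/
def passCrossing (k : ℕ) (V : List (Handleslide R)) : List (Handleslide R) :=
  (V.map fun h => (⟨Equiv.swap k (k + 1) h.top, Equiv.swap k (k + 1) h.bot, h.coeff⟩ :
    Handleslide R)).foldr insertSlide []

/-- Slide a collection past a right cusp of the strands `k` and `k + 1`; the handleslides with an
endpoint on these strands are erased. -/
def passRightCusp (k : ℕ) (V : List (Handleslide R)) : List (Handleslide R) :=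
  (V.filter fun h => h.top ≠ k ∧ h.top ≠ k + 1 ∧ h.bot ≠ k ∧ h.bot ≠ k + 1).map fun h =>
    ⟨if h.top < k then h.top else h.top - 2, if h.bot < k then h.bot else h.bot - 2, h.coeff⟩

end Moves

/-! ### The map `Φ` from SR-form to A-form -/

namespace MCS

variable {F : Type*} [Field F] {D : FrontDiagram} {pts : D.MarkedPoints} (C : MCS F D pts)
  (ρ : NormalRuling D) {M : ℕ} (μ : D.MaslovPotential M) (m : ℕ)

/-- The coefficient of the handleslide of `C` between the strands `k` and `k + 1` immediately to the
left of event `l`, which is a trivial one if `C` has none (as at an `m`-graded departure). -/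
def preCoeff (k l : ℕ) : F := slideCoeff k (k + 1) (C.preSlides ρ μ m l)

open Classical in
/-- The collection of handleslides that arrives from the left at event `l` during the construction
of `Φ(C)`, just to the left of the handleslides of `C` near event `l`. It is empty up to the first
crossing.  At an `m`-graded crossing, the handleslide of `C` to the left of the crossing is
incorporated, then the handleslide on the crossing strands is removed to the left, the rest is moved
past the crossing, and the handleslides of `C` to the right of the crossing are incorporated. -/
def phiCollection : ℕ → List (Handleslide F)
  | 0 => []
  | l + 1 =>
      match D.events[l]? with
      | some (.crossing k) =>
          if D.IsGradedCrossing μ m l then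
            (C.postSlides ρ μ m l).foldl (fun V h => incorporate h V)
              (passCrossing k (removeSlide k (k + 1)
                (incorporate ⟨k, k + 1, C.preCoeff ρ μ m k l⟩ (phiCollection l))))
          else passCrossing k (phiCollection l)
      | some (.rightCusp k) => passRightCusp k (phiCollection l)
      | _ => []

open Classical in
/-- The handleslides of `Φ(C)` in gap `l`.  At an `m`-graded crossing it is the handleslide that is
removed to the left of the collection; at a right cusp, if `m = 1`, it is the handleslide of `C`
merged with the one of the collection on the two strands of the cusp.  All others are erased. -/
def phiSlides (l : ℕ) : List (Handleslide F) :=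
  match D.events[l]? with
  | some (.crossing k) =>
      if D.IsGradedCrossing μ m l then
        [⟨k, k + 1, slideCoeff k (k + 1)
          (incorporate ⟨k, k + 1, C.preCoeff ρ μ m k l⟩ (C.phiCollection ρ μ m l))⟩]
      else []
  | some (.rightCusp k) =>
      if m = 1 then
        [⟨k, k + 1, slideCoeff k (k + 1) (C.phiCollection ρ μ m l) + C.preCoeff ρ μ m k l⟩]
      else []
  | _ => []

/-- `A` is the A-form MCS `Φ(C)`, where `C` is in SR-form compatible with `ρ`.  (An MCS with simple
left cusps is determined by its handleslides.) -/
def IsPhi (A : MCS F D pts) : Prop :=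
  A.IsAForm μ m ∧ ∀ l ≤ D.events.length, A.slides l = C.phiSlides ρ μ m l

end MCS

/-! ### Laurent polynomials -/

/-- The ring `F[x_s^{±1} (s ∈ S), z_t (t ∈ T)]`, as the monoid algebra of the exponents. -/
abbrev LaurentPoly (F S T : Type*) [Field F] : Type _ := AddMonoidAlgebra F ((S →₀ ℤ) × (T →₀ ℕ))

/-- The value of a Laurent polynomial at `x_s = x s` (non-zero) and `z_t = z t`. -/
def LaurentPoly.eval {F S T : Type*} [Field F] (g : LaurentPoly F S T) (x : S → F) (z : T → F) : F :=
  g.coeff.sum fun e c => c * (e.1.prod fun s n => x s ^ n) * (e.2.prod fun t n => z t ^ n)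

end

/-! ### Handleslides as elementary chain isomorphisms -/

section SlideMaps

variable {R : Type*} [CommRing R]

theorem end_ext_stdE {f g : Module.End R (ℕ →₀ R)} (h : ∀ i, f (stdE R i) = g (stdE R i)) :
    f = g := by
  refine Finsupp.lhom_ext' fun i => LinearMap.ext_ring ?_
  simpa [stdE] using h i

theorem stdE_apply (i j : ℕ) : stdE R i j = if i = j then 1 else 0 := by
  simp [stdE, Finsupp.single_apply]

theorem slideMap_apply (h : Handleslide R) (x : ℕ →₀ R) :
    slideMap h x = x - (h.coeff * x h.top) • stdE R h.bot := by
  simp [slideMap, stdE]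

theorem slideMap_stdE (h : Handleslide R) (i : ℕ) :
    slideMap h (stdE R i) = stdE R i - if i = h.top then h.coeff • stdE R h.bot else 0 := by
  rw [slideMap_apply, stdE_apply]
  split_ifs <;> simp

theorem slideMap_stdE_top (a b : ℕ) (r : R) :
    slideMap ⟨a, b, r⟩ (stdE R a) = stdE R a - r • stdE R b := by
  simp [slideMap_stdE]

theorem slideMap_stdE_of_ne {a b i : ℕ} (r : R) (h : i ≠ a) :
    slideMap ⟨a, b, r⟩ (stdE R i) = stdE R i := by
  simp [slideMap_stdE, h]

theorem slideMap_zero (a b : ℕ) : slideMap (⟨a, b, 0⟩ : Handleslide R) = 1 := by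
  refine end_ext_stdE fun i => ?_
  simp [slideMap_stdE]

theorem slideMap_mul_sameEnds {a b : ℕ} (hab : a ≠ b) (r s : R) :
    slideMap ⟨a, b, r⟩ * slideMap ⟨a, b, s⟩ = slideMap ⟨a, b, s + r⟩ := by
  refine end_ext_stdE fun i => ?_
  by_cases hi : i = a
  · subst hi
    simp only [Module.End.mul_apply, slideMap_stdE_top, map_sub, map_smul,
      slideMap_stdE_of_ne _ hab.symm]
    module
  · simp [Module.End.mul_apply, slideMap_stdE_of_ne _ hi]

theorem slideMap_mul_neg {a b : ℕ} (hab : a ≠ b) (r : R) :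
    slideMap ⟨a, b, r⟩ * slideMap ⟨a, b, -r⟩ = 1 := by
  rw [slideMap_mul_sameEnds hab, neg_add_cancel, slideMap_zero]

theorem slideMap_neg_mul {a b : ℕ} (hab : a ≠ b) (r : R) :
    slideMap ⟨a, b, -r⟩ * slideMap ⟨a, b, r⟩ = 1 := by
  rw [slideMap_mul_sameEnds hab, add_neg_cancel, slideMap_zero]

theorem slideMap_isUnit {h : Handleslide R} (hh : h.top ≠ h.bot) : IsUnit (slideMap h) :=
  ⟨⟨slideMap h, slideMap ⟨h.top, h.bot, -h.coeff⟩, slideMap_mul_neg hh _, slideMap_neg_mul hh _⟩,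
    rfl⟩

theorem slideMap_commute {g h : Handleslide R} (h1 : g.bot ≠ h.top) (h2 : g.top ≠ h.bot) :
    slideMap g * slideMap h = slideMap h * slideMap g := by
  refine end_ext_stdE fun i => ?_
  simp only [Module.End.mul_apply, slideMap_stdE, map_sub]
  split_ifs <;> simp [slideMap_stdE, h1, h2.symm]
  abel

/-- Interchanging two handleslides, the left one ending where the right one starts. -/
theorem slideMap_mul_of_bot_eq_top {a b c : ℕ} (hab : a ≠ b) (hbc : b ≠ c) (hac : a ≠ c) (r s : R) :
    slideMap ⟨b, c, s⟩ * slideMap ⟨a, b, r⟩ =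
      slideMap ⟨a, b, r⟩ * slideMap ⟨a, c, -(r * s)⟩ * slideMap ⟨b, c, s⟩ := by
  refine end_ext_stdE fun i => ?_
  rw [mul_assoc]
  simp only [Module.End.mul_apply]
  by_cases hi : i = a
  · subst hi
    simp only [slideMap_stdE_top, slideMap_stdE_of_ne _ hab, slideMap_stdE_of_ne _ hac.symm,
      map_sub, map_smul]
    module
  · by_cases hi' : i = b
    · subst hi'
      simp only [slideMap_stdE_top, slideMap_stdE_of_ne _ hab.symm, slideMap_stdE_of_ne _ hac.symm,
        map_sub, map_smul]
    · simp [slideMap_stdE_of_ne _ hi, slideMap_stdE_of_ne _ hi']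

/-- Interchanging two handleslides, the right one ending where the left one starts. -/
theorem slideMap_mul_of_top_eq_bot {a b c : ℕ} (hab : a ≠ b) (hbc : b ≠ c) (hac : a ≠ c) (r s : R) :
    slideMap ⟨a, b, s⟩ * slideMap ⟨b, c, r⟩ =
      slideMap ⟨b, c, r⟩ * slideMap ⟨a, c, r * s⟩ * slideMap ⟨a, b, s⟩ := by
  refine end_ext_stdE fun i => ?_
  rw [mul_assoc]
  simp only [Module.End.mul_apply]
  by_cases hi : i = a
  · subst hi
    simp only [slideMap_stdE_top, slideMap_stdE_of_ne _ hab,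
      slideMap_stdE_of_ne _ hab.symm, slideMap_stdE_of_ne _ hbc.symm, map_sub, map_smul]
    module
  · by_cases hi' : i = b
    · subst hi'
      simp only [slideMap_stdE_top, slideMap_stdE_of_ne _ hab.symm, slideMap_stdE_of_ne _ hac.symm,
        map_sub, map_smul]
    · simp [slideMap_stdE_of_ne _ hi, slideMap_stdE_of_ne _ hi']

theorem swapMap_stdE (k i : ℕ) : swapMap R k (stdE R i) = stdE R (Equiv.swap k (k + 1) i) := by
  simp [swapMap, stdE, Finsupp.lmapDomain_apply, Finsupp.mapDomain_single]

theorem swapMap_mul_self (k : ℕ) : swapMap R k * swapMap R k = 1 := by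
  refine end_ext_stdE fun i => ?_
  simp [Module.End.mul_apply, swapMap_stdE]

theorem swapMap_slideMap (k : ℕ) (h : Handleslide R) :
    swapMap R k * slideMap h * swapMap R k =
      slideMap ⟨Equiv.swap k (k + 1) h.top, Equiv.swap k (k + 1) h.bot, h.coeff⟩ := by
  refine end_ext_stdE fun i => ?_
  simp only [Module.End.mul_apply, swapMap_stdE, slideMap_stdE, map_sub, Equiv.swap_apply_self]
  congr 1
  by_cases hi : Equiv.swap k (k + 1) i = h.top
  · have : i = Equiv.swap k (k + 1) h.top := by rw [← hi, Equiv.swap_apply_self]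
    rw [if_pos hi, if_pos this, map_smul, swapMap_stdE]
  · have : i ≠ Equiv.swap k (k + 1) h.top := by
      rintro rfl; exact hi (Equiv.swap_apply_self _ _ _)
    rw [if_neg hi, if_neg this, map_zero]

end SlideMaps

/-! ### Ordered collections of handleslides -/

section Collections

variable {R : Type*}

/-- The endpoints of all members of the collection satisfy `P`.  An interchange of handleslides on
`a < b` and `b < c` creates one on `a < c`, so that transitive `P` are preserved by the moves. -/
def AllEnds (P : ℕ → ℕ → Prop) (V : List (Handleslide R)) : Prop := ∀ g ∈ V, P g.top g.bot

/-- The collection is properly ordered; in particular it has at most one member for each pair of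
endpoints. -/
def IsOrdered (V : List (Handleslide R)) : Prop := V.Pairwise Handleslide.Prec

theorem AllEnds.nil {P : ℕ → ℕ → Prop} : AllEnds P ([] : List (Handleslide R)) := by
  simp [AllEnds]

theorem allEnds_cons {P : ℕ → ℕ → Prop} {g : Handleslide R} {V : List (Handleslide R)} :
    AllEnds P (g :: V) ↔ P g.top g.bot ∧ AllEnds P V := by simp [AllEnds]

theorem AllEnds.mono {P Q : ℕ → ℕ → Prop} (h : ∀ a b, P a b → Q a b) {V : List (Handleslide R)}
    (hV : AllEnds P V) : AllEnds Q V := fun g hg => h _ _ (hV g hg)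

theorem AllEnds.and {P Q : ℕ → ℕ → Prop} {V : List (Handleslide R)} (hP : AllEnds P V)
    (hQ : AllEnds Q V) : AllEnds (fun a b => P a b ∧ Q a b) V := fun g hg => ⟨hP g hg, hQ g hg⟩

theorem Handleslide.prec_of_not {g h : Handleslide R} (h1 : ¬ h.SameEnds g) (h2 : ¬ h.Prec g) :
    g.Prec h := by
  unfold Handleslide.Prec Handleslide.SameEnds at *; omega

/-- `Prec` depends on the endpoints only. -/
theorem isOrdered_cons {g : Handleslide R} {V : List (Handleslide R)} :
    IsOrdered (g :: V) ↔
      AllEnds (fun a b => a < g.top ∨ (g.top = a ∧ g.bot < b)) V ∧ IsOrdered V := by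
  simp [IsOrdered, AllEnds, Handleslide.Prec]

theorem IsOrdered.allEnds_top_le {g : Handleslide R} {V : List (Handleslide R)}
    (hV : IsOrdered (g :: V)) : AllEnds (fun a _ => a ≤ g.top) V :=
  (isOrdered_cons.1 hV).1.mono fun a b h => by omega

variable [CommRing R]

/-- The composite of the slide maps of a collection.  The collection is listed from right to left,
so that the product of endomorphisms applies the leftmost handleslide first. -/
noncomputable def slideProd (V : List (Handleslide R)) : Module.End R (ℕ →₀ R) :=
  (V.map slideMap).prod

theorem slideProd_nil : slideProd ([] : List (Handleslide R)) = 1 := rfl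

theorem slideProd_cons (h : Handleslide R) (V : List (Handleslide R)) :
    slideProd (h :: V) = slideMap h * slideProd V := by simp [slideProd]

theorem slideProd_isUnit {V : List (Handleslide R)} (hV : AllEnds (· < ·) V) :
    IsUnit (slideProd V) := by
  induction V with
  | nil => exact isUnit_one
  | cons g V ih =>
    rw [allEnds_cons] at hV
    rw [slideProd_cons]
    exact (slideMap_isUnit hV.1.ne).mul (ih hV.2)

/-! ### Insertion -/

theorem AllEnds.insertSlide {P : ℕ → ℕ → Prop} {h : Handleslide R} {V : List (Handleslide R)}
    (hh : P h.top h.bot) (hV : AllEnds P V) : AllEnds P (insertSlide h V) := by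
  induction V with
  | nil => simpa [_root_.insertSlide, AllEnds] using hh
  | cons g V ih =>
    rw [allEnds_cons] at hV
    unfold _root_.insertSlide
    split_ifs
    · exact allEnds_cons.2 hV
    · exact allEnds_cons.2 ⟨hh, allEnds_cons.2 hV⟩
    · exact allEnds_cons.2 ⟨hV.1, ih hV.2⟩

theorem AllEnds.foldr_insertSlide {P : ℕ → ℕ → Prop} {L V : List (Handleslide R)}
    (hL : AllEnds P L) (hV : AllEnds P V) : AllEnds P (L.foldr _root_.insertSlide V) := by
  induction L with
  | nil => exact hV
  | cons g L ih =>
    rw [allEnds_cons] at hL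
    exact (ih hL.2).insertSlide hL.1

theorem IsOrdered.insertSlide {h : Handleslide R} {V : List (Handleslide R)} (hV : IsOrdered V) :
    IsOrdered (insertSlide h V) := by
  induction V with
  | nil => simp [_root_.insertSlide, IsOrdered]
  | cons g V ih =>
    unfold _root_.insertSlide
    split_ifs with h1 h2
    · rw [isOrdered_cons] at hV ⊢
      exact hV
    · rw [isOrdered_cons]
      rw [Handleslide.Prec] at h2
      refine ⟨allEnds_cons.2 ⟨by omega, (isOrdered_cons.1 hV).1.mono fun a b _ => ?_⟩, hV⟩
      omega
    · rw [isOrdered_cons] at hV ⊢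
      exact ⟨hV.1.insertSlide (Handleslide.prec_of_not h1 h2 : g.Prec h), ih hV.2⟩

theorem IsOrdered.foldr_insertSlide {L V : List (Handleslide R)} (hV : IsOrdered V) :
    IsOrdered (L.foldr _root_.insertSlide V) := by
  induction L with
  | nil => exact hV
  | cons g L ih => exact ih.insertSlide

/-- Inserting a handleslide at its place only moves it past handleslides that it commutes with. -/
theorem slideProd_insertSlide {h : Handleslide R} {V : List (Handleslide R)}
    (hV : AllEnds (fun a b => a < b ∧ a ≠ h.bot) V) :
    slideProd (insertSlide h V) = slideMap h * slideProd V := by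
  induction V with
  | nil => simp [insertSlide, slideProd]
  | cons g V ih =>
    rw [allEnds_cons] at hV
    unfold insertSlide
    split_ifs with h1 h2
    · obtain ⟨e1, e2⟩ := h1
      have hg : slideMap h = slideMap ⟨g.top, g.bot, h.coeff⟩ := by rw [← e1, ← e2]
      rw [slideProd_cons, slideProd_cons, ← mul_assoc, hg, ← slideMap_mul_sameEnds hV.1.1.ne]
    · simp only [slideProd_cons]
    · have hgh : g.Prec h := Handleslide.prec_of_not h1 h2
      rw [slideProd_cons, ih hV.2, slideProd_cons, ← mul_assoc, ← mul_assoc,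
        slideMap_commute (g := g) (h := h) _ hV.1.2]
      have := hV.1.1
      unfold Handleslide.Prec at hgh
      omega

/-! ### Interchanging handleslides -/

theorem AllEnds.interchange {P : ℕ → ℕ → Prop} (hP : ∀ a b c, P a b → P b c → P a c)
    {g h : Handleslide R} (hg : P g.top g.bot) (hh : P h.top h.bot) :
    AllEnds P (interchange g h) := by
  unfold _root_.interchange AllEnds
  split_ifs with h1 h2
  · simpa using hP _ _ _ hg (h1 ▸ hh)
  · simpa using hP _ _ _ hh (h2 ▸ hg)
  · simp

theorem slideMap_mul_interchange {g h : Handleslide R} (hg : g.top < g.bot) (hh : h.top < h.bot) :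
    slideMap h * slideMap g = slideMap g * slideProd (interchange g h) * slideMap h := by
  obtain ⟨a, b, r⟩ := g
  obtain ⟨c, d, s⟩ := h
  simp only at hg hh
  unfold interchange
  simp only
  split_ifs with h1 h2
  · subst h1
    simpa [slideProd] using slideMap_mul_of_bot_eq_top hg.ne hh.ne (hg.trans hh).ne r s
  · subst h2
    simpa [slideProd] using slideMap_mul_of_top_eq_bot hh.ne hg.ne (hh.trans hg).ne r s
  · simpa [slideProd] using slideMap_commute (g := ⟨c, d, s⟩) (h := ⟨a, b, r⟩) (Ne.symm h2)
      (Ne.symm h1)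

/-! ### Incorporation -/

theorem AllEnds.incorporate {P : ℕ → ℕ → Prop} (hP : ∀ a b c, P a b → P b c → P a c)
    {h : Handleslide R} {V : List (Handleslide R)} (hh : P h.top h.bot) (hV : AllEnds P V) :
    AllEnds P (incorporate h V) := by
  induction V with
  | nil => simpa [_root_.incorporate, AllEnds] using hh
  | cons g V ih =>
    rw [allEnds_cons] at hV
    unfold _root_.incorporate
    split_ifs
    · exact allEnds_cons.2 hV
    · exact allEnds_cons.2 ⟨hh, allEnds_cons.2 hV⟩
    · exact allEnds_cons.2 ⟨hV.1, (AllEnds.interchange hP hV.1 hh).foldr_insertSlide (ih hV.2)⟩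

theorem IsOrdered.incorporate {h : Handleslide R} {V : List (Handleslide R)} (hV : IsOrdered V)
    (hh : h.top < h.bot) (hlt : AllEnds (· < ·) V) : IsOrdered (incorporate h V) := by
  induction V with
  | nil => simp [_root_.incorporate, IsOrdered]
  | cons g V ih =>
    rw [allEnds_cons] at hlt
    unfold _root_.incorporate
    split_ifs with h1 h2
    · rw [isOrdered_cons] at hV ⊢
      exact hV
    · rw [isOrdered_cons]
      rw [Handleslide.Prec] at h2
      refine ⟨allEnds_cons.2 ⟨by omega, (isOrdered_cons.1 hV).1.mono fun a b _ => ?_⟩, hV⟩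
      omega
    · rw [isOrdered_cons] at hV ⊢
      have hgh : g.Prec h := Handleslide.prec_of_not h1 h2
      unfold Handleslide.Prec at hgh
      refine ⟨?_, (ih hV.2 hlt.2).foldr_insertSlide⟩
      -- To come after `g` in the order is a transitive condition on the endpoints.
      have hP : ∀ a b c : ℕ, (a < b ∧ (a < g.top ∨ (g.top = a ∧ g.bot < b))) →
          (b < c ∧ (b < g.top ∨ (g.top = b ∧ g.bot < c))) →
          (a < c ∧ (a < g.top ∨ (g.top = a ∧ g.bot < c))) := by omega
      have hinc := AllEnds.incorporate hP (h := h) (by omega) (hlt.2.and hV.1)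
      refine AllEnds.foldr_insertSlide ?_ (hinc.mono fun _ _ => And.right)
      unfold AllEnds interchange
      split_ifs with h3 h4
      · omega
      · simp only [List.mem_singleton, forall_eq]; omega
      · simp

/-- Incorporating a handleslide composes the slide maps. -/
theorem slideProd_incorporate {h : Handleslide R} {V : List (Handleslide R)} (hh : h.top < h.bot)
    (hV : IsOrdered V) (hlt : AllEnds (· < ·) V) :
    slideProd (incorporate h V) = slideMap h * slideProd V := by
  induction V with
  | nil => simp [incorporate, slideProd]
  | cons g V ih =>
    have htop := hV.allEnds_top_le
    rw [allEnds_cons] at hlt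
    rw [isOrdered_cons] at hV
    unfold incorporate
    split_ifs with h1 h2
    · obtain ⟨e1, e2⟩ := h1
      have hg : slideMap h = slideMap ⟨g.top, g.bot, h.coeff⟩ := by rw [← e1, ← e2]
      rw [slideProd_cons, slideProd_cons, ← mul_assoc, hg, ← slideMap_mul_sameEnds hlt.1.ne]
    · simp only [slideProd_cons]
    · have hgh : g.Prec h := Handleslide.prec_of_not h1 h2
      unfold Handleslide.Prec at hgh
      have key : slideProd ((interchange g h).foldr insertSlide (incorporate h V)) =
          slideProd (interchange g h) * slideProd (incorporate h V) := by
        have hlt1 := hlt.1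
        -- The members of `incorporate h V` start above the lower end of `g`.
        have hinc : AllEnds (fun a b => a < b ∧ a ≤ g.top) (incorporate h V) :=
          AllEnds.incorporate (P := fun a b => a < b ∧ a ≤ g.top) (by intros; omega) (by omega)
            (hlt.2.and htop)
        unfold interchange
        split_ifs with h3 h4
        · omega
        · simp only [List.foldr_cons, List.foldr_nil]
          rw [slideProd_insertSlide (hinc.mono fun a b _ => by simp only; omega)]
          simp [slideProd]
        · simp [slideProd]
      rw [slideProd_cons, key, ih hV.2 hlt.2, slideProd_cons, ← mul_assoc, ← mul_assoc, ← mul_assoc,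
        slideMap_mul_interchange hlt.1 hh]

/-! ### Removal -/

theorem AllEnds.passLeft {P : ℕ → ℕ → Prop} {h : Handleslide R} {V : List (Handleslide R)}
    (hV : AllEnds P V) (hI : ∀ g ∈ V, AllEnds P (_root_.interchange g h)) :
    AllEnds P (passLeft h V) := by
  induction V with
  | nil => exact AllEnds.nil
  | cons g V ih =>
    rw [allEnds_cons] at hV
    refine AllEnds.foldr_insertSlide (hI g (by simp)) (allEnds_cons.2 ⟨hV.1, ih hV.2 ?_⟩)
    exact fun g' hg' => hI g' (by simp [hg'])

theorem AllEnds.removeSlide {P : ℕ → ℕ → Prop} (hP : ∀ a b c, P a b → P b c → P a c) {a b : ℕ}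
    {V : List (Handleslide R)} (hV : AllEnds P V) : AllEnds P (removeSlide a b V) := by
  induction V with
  | nil => exact AllEnds.nil
  | cons g V ih =>
    rw [allEnds_cons] at hV
    unfold _root_.removeSlide
    split_ifs
    · exact AllEnds.passLeft hV.2 fun g' hg' => AllEnds.interchange hP (hV.2 g' hg') hV.1
    · exact allEnds_cons.2 ⟨hV.1, ih hV.2⟩

theorem IsOrdered.passLeft {h : Handleslide R} {V : List (Handleslide R)} (hh : h.top < h.bot)
    (hV : IsOrdered V) (htop : AllEnds (fun a b => a ≤ h.top ∧ a < b) V) :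
    IsOrdered (passLeft h V) := by
  induction V with
  | nil => simp [_root_.passLeft, IsOrdered]
  | cons g V ih =>
    rw [allEnds_cons] at htop
    rw [isOrdered_cons] at hV
    -- An interchange with `g'` keeps the upper end of `g'` and moves its lower end down.
    refine IsOrdered.foldr_insertSlide (isOrdered_cons.2 ⟨AllEnds.passLeft hV.1 ?_, ih hV.2 htop.2⟩)
    intro g' hg'
    have h1 := htop.2 g' hg'
    have h2 := hV.1 g' hg'
    unfold AllEnds interchange
    split_ifs
    · simp only [List.mem_singleton, forall_eq]; omega
    · omega
    · simp

theorem IsOrdered.removeSlide {a b : ℕ} {V : List (Handleslide R)} (hV : IsOrdered V) (hlt : AllEnds (· < ·) V) :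
    IsOrdered (removeSlide a b V) := by
  induction V with
  | nil => simp [_root_.removeSlide, IsOrdered]
  | cons g V ih =>
    have htop := hV.allEnds_top_le
    rw [isOrdered_cons] at hV
    rw [allEnds_cons] at hlt
    unfold _root_.removeSlide
    split_ifs with h1
    · exact hV.2.passLeft hlt.1 (htop.and hlt.2)
    · refine isOrdered_cons.2 ⟨?_, ih hV.2 hlt.2⟩
      have := AllEnds.removeSlide (a := a) (b := b)
        (P := fun c d => c < d ∧ (c < g.top ∨ (g.top = c ∧ g.bot < d)))
        (by intros; omega) (hlt.2.and hV.1)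
      exact this.mono fun _ _ => And.right

theorem slideProd_passLeft {h : Handleslide R} {V : List (Handleslide R)} (hh : h.top < h.bot)
    (htop : AllEnds (fun a b => a ≤ h.top ∧ a < b) V) :
    slideProd (passLeft h V) * slideMap h = slideMap h * slideProd V := by
  induction V with
  | nil => simp [passLeft, slideProd]
  | cons g V ih =>
    rw [allEnds_cons] at htop
    have hg := htop.1
    -- All members start above the lower end of `h`, which is the lower end of a new handleslide.
    have hpass : AllEnds (fun a b => a ≤ h.top ∧ a < b) (passLeft h V) := by
      refine AllEnds.passLeft htop.2 fun g' hg' => ?_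
      have h1 := htop.2 g' hg'
      unfold AllEnds interchange
      split_ifs
      · simp only [List.mem_singleton, forall_eq]; omega
      · omega
      · simp
    have key : slideProd ((interchange g h).foldr insertSlide (g :: passLeft h V)) =
        slideMap g * slideProd (interchange g h) * slideProd (passLeft h V) := by
      unfold interchange
      split_ifs with h3 h4
      · simp only [List.foldr_cons, List.foldr_nil]
        rw [slideProd_insertSlide
          (allEnds_cons.2 ⟨by simp only; omega, hpass.mono fun a b _ => by simp only; omega⟩),
          slideProd_cons, ← mul_assoc, slideMap_commute (by simp only; omega) (by simp only; omega)]
        simp [slideProd]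
      · omega
      · simp [slideProd]
    rw [passLeft, key, mul_assoc, ih htop.2, slideProd_cons, ← mul_assoc, ← mul_assoc,
      slideMap_mul_interchange hg.2 hh]

/-- Removing a handleslide to the left does not change the composite of the slide maps. -/
theorem slideProd_removeSlide {a b : ℕ} {V : List (Handleslide R)} (hV : IsOrdered V)
    (hlt : AllEnds (· < ·) V) :
    slideProd V = slideProd (removeSlide a b V) * slideMap ⟨a, b, slideCoeff a b V⟩ := by
  induction V with
  | nil => simp [removeSlide, slideCoeff, slideMap_zero, slideProd]
  | cons g V ih =>
    have htop := hV.allEnds_top_le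
    rw [isOrdered_cons] at hV
    rw [allEnds_cons] at hlt
    unfold removeSlide slideCoeff
    split_ifs with h1
    · obtain ⟨rfl, rfl⟩ := h1
      rw [slideProd_cons, slideProd_passLeft hlt.1 (htop.and hlt.2)]
    · rw [slideProd_cons, slideProd_cons, mul_assoc, ← ih hV.2 hlt.2]

/-- An ordered collection has at most one handleslide for each pair of endpoints. -/
theorem removeSlide_allEnds_ne {k : ℕ} {V : List (Handleslide R)} (hV : IsOrdered V)
    (hlt : AllEnds (· < ·) V) :
    AllEnds (fun a b => ¬ (a = k ∧ b = k + 1)) (removeSlide k (k + 1) V) := by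
  induction V with
  | nil => exact AllEnds.nil
  | cons g V ih =>
    rw [isOrdered_cons] at hV
    rw [allEnds_cons] at hlt
    unfold removeSlide
    split_ifs with h1
    · -- A handleslide created by an interchange joins strands that are not neighbours.
      have hV' : AllEnds (fun a b => a < b ∧ ¬ (a = k ∧ b = k + 1)) V :=
        (hlt.2.and hV.1).mono fun a b _ => by omega
      refine (AllEnds.passLeft hV' fun g' hg' => ?_).mono fun _ _ => And.right
      have h2 := hV' g' hg'
      have h3 := hlt.2 g' hg'
      unfold AllEnds interchange
      split_ifs
      · simp only [List.mem_singleton, forall_eq]; omega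
      · simp only [List.mem_singleton, forall_eq]; omega
      · simp
    · exact allEnds_cons.2 ⟨h1, ih hV.2 hlt.2⟩

/-! ### Sliding past a crossing -/

theorem isOrdered_passCrossing (k : ℕ) (V : List (Handleslide R)) :
    IsOrdered (passCrossing k V) :=
  IsOrdered.foldr_insertSlide (by simp [IsOrdered])

theorem AllEnds.passCrossing {P Q : ℕ → ℕ → Prop} {k : ℕ}
    (hPQ : ∀ a b, P a b → Q (Equiv.swap k (k + 1) a) (Equiv.swap k (k + 1) b))
    {V : List (Handleslide R)} (hV : AllEnds P V) : AllEnds Q (passCrossing k V) := by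
  refine AllEnds.foldr_insertSlide ?_ AllEnds.nil
  intro g hg
  obtain ⟨g', hg', rfl⟩ := List.mem_map.1 hg
  exact hPQ _ _ (hV g' hg')

theorem swap_lt_swap {k a b : ℕ} (hab : a < b) (h : ¬ (a = k ∧ b = k + 1)) :
    Equiv.swap k (k + 1) a < Equiv.swap k (k + 1) b := by
  simp only [Equiv.swap_apply_def]
  split_ifs <;> omega

/-- A properly ordered collection without handleslide on the crossing strands can be reordered after
the crossing without creating new handleslides. -/
theorem slideProd_passCrossing {k : ℕ} {V : List (Handleslide R)} (hV : IsOrdered V)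
    (hlt : AllEnds (fun a b => a < b ∧ ¬ (a = k ∧ b = k + 1)) V) :
    slideProd (passCrossing k V) = swapMap R k * slideProd V * swapMap R k := by
  induction V with
  | nil => simp [passCrossing, slideProd, swapMap_mul_self]
  | cons g V ih =>
    have htop := hV.allEnds_top_le
    rw [isOrdered_cons] at hV
    rw [allEnds_cons] at hlt
    have hcons : passCrossing k (g :: V) = insertSlide
        ⟨Equiv.swap k (k + 1) g.top, Equiv.swap k (k + 1) g.bot, g.coeff⟩ (passCrossing k V) := rfl
    rw [hcons, slideProd_insertSlide, ih hV.2 hlt.2, slideProd_cons,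
      ← swapMap_slideMap]
    · simp only [mul_assoc]
      rw [← mul_assoc (swapMap R k) (swapMap R k), swapMap_mul_self, one_mul]
    · refine AllEnds.passCrossing (fun a b h => ⟨swap_lt_swap h.1.1 h.1.2, fun h' => ?_⟩)
        (hlt.2.and htop)
      have := (Equiv.swap k (k + 1)).injective h'
      omega

end Collections

/-! ### Triangular and graded differentials -/

section Differentials

variable {R : Type*} [CommRing R]

/-- The endomorphism `d` lowers the degree `ν` of the basis vectors by one. -/
def LowersDegree {m : ℕ} (ν : ℕ → ZMod m) (d : Module.End R (ℕ →₀ R)) : Prop :=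
  ∀ i j, entry d i j ≠ 0 → ν j = ν i - 1

/-- The differential to the right of the handleslide `h`, if `d` is the one to its left. -/
noncomputable def slideConj (h : Handleslide R) (d : Module.End R (ℕ →₀ R)) :
    Module.End R (ℕ →₀ R) :=
  slideMap h * d * slideMap ⟨h.top, h.bot, -h.coeff⟩

theorem slideMap_mul_slideMap_neg {h : Handleslide R} (hh : h.top ≠ h.bot) :
    slideMap h * slideMap ⟨h.top, h.bot, -h.coeff⟩ = 1 := slideMap_mul_neg hh _

theorem slideMap_neg_mul_slideMap {h : Handleslide R} (hh : h.top ≠ h.bot) :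
    slideMap ⟨h.top, h.bot, -h.coeff⟩ * slideMap h = 1 := slideMap_neg_mul hh _

theorem slideConj_mul {h : Handleslide R} (hh : h.top ≠ h.bot) (d : Module.End R (ℕ →₀ R)) :
    slideConj h d * slideMap h = slideMap h * d := by
  rw [slideConj, mul_assoc, slideMap_neg_mul_slideMap hh, mul_one]

theorem isChainIso_slideConj {h : Handleslide R} (hh : h.top ≠ h.bot)
    (d : Module.End R (ℕ →₀ R)) : IsChainIso (slideMap h) d (slideConj h d) :=
  ⟨(Module.End.isUnit_iff _).1 (slideMap_isUnit hh), (slideConj_mul hh d).symm⟩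

theorem IsChainIso.eq_slideConj {h : Handleslide R} (hh : h.top ≠ h.bot)
    {d d' : Module.End R (ℕ →₀ R)} (hd : IsChainIso (slideMap h) d d') : d' = slideConj h d :=
  (slideMap_isUnit hh).mul_right_cancel (hd.2.symm.trans (slideConj_mul hh d).symm)

theorem entry_slideConj (h : Handleslide R) (d : Module.End R (ℕ →₀ R)) (i j : ℕ) :
    entry (slideConj h d) i j =
      entry d i j - (if j = h.bot then h.coeff * entry d i h.top else 0) +
        (if i = h.top then h.coeff * (entry d h.bot j -
          if j = h.bot then h.coeff * entry d h.bot h.top else 0) else 0) := by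
  simp only [entry, slideConj, Module.End.mul_apply]
  rw [slideMap_stdE]
  by_cases hi : i = h.top
  · simp only [hi, if_true, map_sub, map_smul, slideMap_apply, Finsupp.sub_apply,
      Finsupp.smul_apply, stdE_apply, smul_eq_mul, eq_comm (a := h.bot)]
    split_ifs <;> ring
  · simp only [hi, if_false, sub_zero, slideMap_apply, Finsupp.sub_apply,
      Finsupp.smul_apply, stdE_apply, smul_eq_mul, eq_comm (a := h.bot)]
    split_ifs <;> ring

theorem IsTriangularDifferential.entry_eq_zero {s : ℕ} {d : Module.End R (ℕ →₀ R)}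
    (hd : IsTriangularDifferential s d) {i j : ℕ} (h : ¬ (i < j ∧ j < s)) : entry d i j = 0 := by
  by_contra h'
  exact h (hd.1 i j h')

theorem IsTriangularDifferential.apply_apply {s : ℕ} {d : Module.End R (ℕ →₀ R)}
    (hd : IsTriangularDifferential s d) (x : ℕ →₀ R) : d (d x) = 0 :=
  LinearMap.congr_fun hd.2 x

theorem IsTriangularDifferential.slideConj {s : ℕ} {d : Module.End R (ℕ →₀ R)}
    (hd : IsTriangularDifferential s d) {h : Handleslide R} (h1 : h.top < h.bot) (h2 : h.bot < s) :
    IsTriangularDifferential s (slideConj h d) := by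
  constructor
  · intro i j hij
    by_contra hc
    apply hij
    rw [entry_slideConj, hd.entry_eq_zero hc, hd.entry_eq_zero (i := h.bot) (j := h.top) (by omega)]
    split_ifs with h3 h4 h4
    · rw [hd.entry_eq_zero (j := h.top) (by omega), hd.entry_eq_zero (i := h.bot) (by omega)]; ring
    · rw [hd.entry_eq_zero (j := h.top) (by omega)]; ring
    · rw [hd.entry_eq_zero (i := h.bot) (by omega)]; ring
    · ring
  · change _root_.slideConj h d * _root_.slideConj h d = 0
    have h0 : d * d = 0 := hd.2
    calc _root_.slideConj h d * _root_.slideConj h d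
        = slideMap h * d * (slideMap ⟨h.top, h.bot, -h.coeff⟩ * slideMap h) * d *
            slideMap ⟨h.top, h.bot, -h.coeff⟩ := by simp only [_root_.slideConj, mul_assoc]
      _ = slideMap h * (d * d) * slideMap ⟨h.top, h.bot, -h.coeff⟩ := by
          rw [slideMap_neg_mul_slideMap h1.ne, mul_one]; simp only [mul_assoc]
      _ = 0 := by rw [h0, mul_zero, zero_mul]

theorem LowersDegree.slideConj {m : ℕ} {ν : ℕ → ZMod m} {d : Module.End R (ℕ →₀ R)}
    (hd : LowersDegree ν d) {h : Handleslide R} (hh : ν h.top = ν h.bot) :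
    LowersDegree ν (slideConj h d) := by
  intro i j hij
  by_contra hc
  apply hij
  have key : ∀ i j, ν j ≠ ν i - 1 → entry d i j = 0 := fun i j hn => by
    by_contra h'
    exact hn (hd i j h')
  rw [entry_slideConj, key i j hc]
  have e1 : j = h.bot → entry d i h.top = 0 := fun e => key _ _ (by rw [hh, ← e]; exact hc)
  have e2 : i = h.top → entry d h.bot j = 0 := fun e => key _ _ (by rw [← hh, ← e]; exact hc)
  have e3 : i = h.top → j = h.bot → entry d h.bot h.top = 0 := fun e e' =>
    key _ _ fun H => hc <| by
      rw [← hh] at H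
      rw [e, e', ← hh]
      exact H
  split_ifs with h3 h4 h4
  · rw [e1 h3, e2 h4, e3 h4 h3]; ring
  · rw [e1 h3]; ring
  · rw [e2 h4]; ring
  · ring

/-- The coefficients of a differential on neighbouring strands are not changed by handleslides. -/
theorem entry_slideConj_adjacent {s : ℕ} {d : Module.End R (ℕ →₀ R)}
    (hd : IsTriangularDifferential s d) {h : Handleslide R} (h1 : h.top < h.bot) (k : ℕ) :
    entry (slideConj h d) k (k + 1) = entry d k (k + 1) := by
  rw [entry_slideConj, hd.entry_eq_zero (i := h.bot) (j := h.top) (by omega)]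
  split_ifs with h3 h4 h4
  · rw [hd.entry_eq_zero (j := h.top) (by omega), hd.entry_eq_zero (i := h.bot) (by omega)]; ring
  · rw [hd.entry_eq_zero (j := h.top) (by omega)]; ring
  · rw [hd.entry_eq_zero (i := h.bot) (by omega)]; ring
  · ring

/-- Differentials that are intertwined by a collection of handleslides have the same coefficients on
neighbouring strands. -/
theorem entry_adjacent_of_slideProd {s : ℕ} {V : List (Handleslide R)}
    (hV : AllEnds (fun a b => a < b ∧ b < s) V) {d d' : Module.End R (ℕ →₀ R)}
    (hd : IsTriangularDifferential s d') (h : slideProd V * d = d' * slideProd V) (k : ℕ) :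
    entry d k (k + 1) = entry d' k (k + 1) := by
  induction V generalizing d' with
  | nil => rw [slideProd_nil, one_mul, mul_one] at h; rw [h]
  | cons g V ih =>
    rw [allEnds_cons] at hV
    have hg : IsTriangularDifferential s (slideConj ⟨g.top, g.bot, -g.coeff⟩ d') :=
      hd.slideConj hV.1.1 hV.1.2
    rw [ih hV.2 hg, entry_slideConj_adjacent hd (by exact hV.1.1)]
    refine (slideMap_isUnit hV.1.1.ne : IsUnit (slideMap g)).mul_left_cancel ?_
    rw [slideProd_cons] at h
    rw [← mul_assoc, h, slideConj, neg_neg]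
    simp only [← mul_assoc]
    rw [slideMap_mul_slideMap_neg hV.1.1.ne, one_mul]

/-! ### Differentials at crossings -/

theorem swapMap_apply (k : ℕ) (x : ℕ →₀ R) (j : ℕ) :
    swapMap R k x j = x (Equiv.swap k (k + 1) j) := by
  rw [swapMap, Finsupp.lmapDomain_apply, Finsupp.mapDomain_equiv_apply, Equiv.symm_swap]

theorem entry_swapMap (k : ℕ) (d : Module.End R (ℕ →₀ R)) (i j : ℕ) :
    entry (swapMap R k * d * swapMap R k) i j =
      entry d (Equiv.swap k (k + 1) i) (Equiv.swap k (k + 1) j) := by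
  simp only [entry, Module.End.mul_apply, swapMap_stdE, swapMap_apply]

theorem swapMap_bijective (k : ℕ) : Function.Bijective (swapMap R k) :=
  (Module.End.isUnit_iff _).1 ⟨⟨_, _, swapMap_mul_self k, swapMap_mul_self k⟩, rfl⟩

theorem isChainIso_swapMap (k : ℕ) (d : Module.End R (ℕ →₀ R)) :
    IsChainIso (swapMap R k) d (swapMap R k * d * swapMap R k) := by
  refine ⟨swapMap_bijective k, ?_⟩
  change swapMap R k * d = swapMap R k * d * swapMap R k * swapMap R k
  rw [mul_assoc _ (swapMap R k), swapMap_mul_self, mul_one]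

theorem swap_lt_iff {k s i : ℕ} (hk : k + 1 < s) : Equiv.swap k (k + 1) i < s ↔ i < s := by
  rw [Equiv.swap_apply_def]
  split_ifs <;> omega

theorem IsTriangularDifferential.swapMap {s k : ℕ} {d : Module.End R (ℕ →₀ R)}
    (hd : IsTriangularDifferential s d) (hk : k + 1 < s) (h0 : entry d k (k + 1) = 0) :
    IsTriangularDifferential s (swapMap R k * d * swapMap R k) := by
  constructor
  · intro i j hij
    rw [entry_swapMap] at hij
    obtain ⟨h1, h2⟩ := hd.1 _ _ hij
    refine ⟨?_, (swap_lt_iff hk).1 h2⟩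
    have := swap_lt_swap h1 (k := k) (fun h => hij (by rw [h.1, h.2, h0]))
    simpa using this
  · change (_root_.swapMap R k * d * _root_.swapMap R k) *
      (_root_.swapMap R k * d * _root_.swapMap R k) = 0
    have h0 : d * d = 0 := hd.2
    calc _ = _root_.swapMap R k * d * (_root_.swapMap R k * _root_.swapMap R k) * d *
              _root_.swapMap R k := by simp only [mul_assoc]
      _ = _root_.swapMap R k * (d * d) * _root_.swapMap R k := by
          rw [swapMap_mul_self, mul_one]; simp only [mul_assoc]
      _ = 0 := by rw [h0, mul_zero, zero_mul]

theorem LowersDegree.swapMap {m : ℕ} {ν ν' : ℕ → ZMod m} {s k : ℕ} {d : Module.End R (ℕ →₀ R)}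
    (hs : IsTriangularDifferential s d) (hd : LowersDegree ν d)
    (hν : ∀ i < s, ν' (Equiv.swap k (k + 1) i) = ν i) :
    LowersDegree ν' (swapMap R k * d * swapMap R k) := by
  intro i j hij
  rw [entry_swapMap] at hij
  have h1 := hs.1 _ _ hij
  have h2 := hd _ _ hij
  rw [← hν _ h1.2, ← hν _ (h1.1.trans h1.2)] at h2
  simpa using h2

/-! ### Differentials at cusps -/

theorem skip_injective (k : ℕ) : Function.Injective (skip k) := by
  intro i j h
  unfold skip at h
  split_ifs at h <;> omega

theorem skip_ne (k i : ℕ) : skip k i ≠ k ∧ skip k i ≠ k + 1 := by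
  unfold skip
  split_ifs <;> omega

theorem skip_lt_skip {k i j : ℕ} : skip k i < skip k j ↔ i < j := by
  unfold skip
  split_ifs <;> omega

theorem exists_skip {k i : ℕ} (h1 : i ≠ k) (h2 : i ≠ k + 1) : ∃ j, skip k j = i := by
  by_cases h : i < k
  · exact ⟨i, by simp [skip, h]⟩
  · exact ⟨i - 2, by unfold skip; split_ifs <;> omega⟩

theorem skipMap_stdE (k i : ℕ) : skipMap R k (stdE R i) = stdE R (skip k i) := by
  simp [skipMap, stdE, Finsupp.lmapDomain_apply, Finsupp.mapDomain_single]

theorem skipMap_apply_skip (k : ℕ) (x : ℕ →₀ R) (i : ℕ) : skipMap R k x (skip k i) = x i := by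
  rw [skipMap, Finsupp.lmapDomain_apply, Finsupp.mapDomain_apply (skip_injective k)]

theorem skipMap_apply_of_forall_ne {k : ℕ} (x : ℕ →₀ R) {j : ℕ} (h : ∀ i, skip k i ≠ j) :
    skipMap R k x j = 0 := by
  rw [skipMap, Finsupp.lmapDomain_apply, Finsupp.mapDomain_of_notMem_range]
  rintro ⟨i, hi⟩
  exact h i hi

/-- The complex on the side of a cusp with fewer strands is determined by the one on the other. -/
theorem IsCuspIso.unique {k : ℕ} {d₁ d₂ d : Module.End R (ℕ →₀ R)} (h₁ : IsCuspIso k d₁ d)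
    (h₂ : IsCuspIso k d₂ d) : d₁ = d₂ := by
  refine LinearMap.ext fun x => h₁.1.1 ?_
  exact (LinearMap.congr_fun h₁.2 x).trans (LinearMap.congr_fun h₂.2 x).symm

/-- For a vector `w` whose coefficient at `e_{k+1}` has inverse `a`: the linear map that subtracts a
multiple of `w` to cancel `e_{k+1}`, drops `e_k`, and renumbers the other basis vectors. -/
noncomputable def cuspProj (k : ℕ) (a : R) (w : ℕ →₀ R) : Module.End R (ℕ →₀ R) :=
  Finsupp.lcomapDomain (skip k) (skip_injective k) ∘ₗ
    (LinearMap.id - (a • Finsupp.lapply (k + 1)).smulRight w)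

theorem cuspProj_apply (k : ℕ) (a : R) (w x : ℕ →₀ R) (j : ℕ) :
    cuspProj k a w x j = x (skip k j) - a * x (k + 1) * w (skip k j) := by
  simp [cuspProj, Finsupp.lcomapDomain]

/-- The quotient of a triangular complex by the acyclic subcomplex spanned by `e_k` and `d e_k`,
where `⟨d e_k, e_{k+1}⟩` is a unit, is again triangular and graded.  If `k` is even, the coefficients
at the pairs of strands `2p`, `2p + 1` are unchanged: the correction by a multiple of `d e_k` only
affects `⟨d e_i, e_j⟩` for `i < k` and `k + 1 < j`. -/
theorem exists_isCuspIso {s k : ℕ} {d : Module.End R (ℕ →₀ R)}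
    (hd : IsTriangularDifferential s d) (hk : k + 1 < s) (hu : IsUnit (entry d k (k + 1)))
    {m : ℕ} {ν ν' : ℕ → ZMod m} (hg : LowersDegree ν d)
    (hν : ∀ i < s - 2, ν' i = ν (skip k i)) (hcusp : ν k = ν (k + 1) + 1) :
    ∃ d', IsTriangularDifferential (s - 2) d' ∧ LowersDegree ν' d' ∧ IsCuspIso k d' d ∧
      ∀ p q, k = 2 * q →
        entry d' (2 * p) (2 * p + 1) = entry d (skip k (2 * p)) (skip k (2 * p) + 1) := by
  obtain ⟨a, ha⟩ := hu.exists_left_inv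
  set w := d (stdE R k) with hw
  have hwk : ∀ j, ¬ (k < j ∧ j < s) → w j = 0 := fun j hj => hd.entry_eq_zero hj
  have ha' : a * w (k + 1) = 1 := ha
  set π := cuspProj k a w with hπ
  set Q : Submodule R (ℕ →₀ R) := Submodule.span R {stdE R k, w} with hQ
  -- `π` splits the inclusion of the other basis vectors, and its kernel is `Q`.
  have hπskip : ∀ x, π (skipMap R k x) = x := fun x => by
    ext j
    rw [hπ, cuspProj_apply, skipMap_apply_skip,
      skipMap_apply_of_forall_ne x (fun i => (skip_ne k i).2)]
    ring
  have hQπ : ∀ x ∈ Q, π x = 0 := by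
    intro x hx
    have : Q ≤ LinearMap.ker π := by
      rw [hQ, Submodule.span_le]
      rintro y (rfl | rfl)
      · ext j
        simp [hπ, cuspProj_apply, stdE_apply, (skip_ne k j).1.symm]
      · ext j
        simp [hπ, cuspProj_apply, ha']
    exact this hx
  have hπQ : ∀ x, π x = 0 → x ∈ Q := by
    intro x hx
    have : x = (x k - a * x (k + 1) * w k) • stdE R k + (a * x (k + 1)) • w := by
      ext j
      simp only [Finsupp.add_apply, Finsupp.smul_apply, smul_eq_mul, stdE_apply]
      by_cases h1 : j = k
      · subst h1; simp
      · by_cases h2 : j = k + 1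
        · subst h2
          simp only [Ne.symm h1, if_false]
          linear_combination (- x (k + 1)) * ha'
        · obtain ⟨i, rfl⟩ := exists_skip h1 h2
          have := DFunLike.congr_fun hx i
          rw [hπ, cuspProj_apply, Finsupp.zero_apply] at this
          simp only [(skip_ne k i).1.symm, if_false]
          linear_combination this
    rw [this]
    exact Q.add_mem (Q.smul_mem _ (Submodule.subset_span (by simp)))
      (Q.smul_mem _ (Submodule.subset_span (by simp)))
  have hsub : ∀ y, skipMap R k (π y) - y ∈ Q := fun y => hπQ _ (by rw [map_sub, hπskip, sub_self])
  have hdQ : ∀ x ∈ Q, d x ∈ Q := by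
    intro x hx
    have : Submodule.span R {stdE R k, w} ≤ Q.comap d := by
      rw [Submodule.span_le]
      rintro y (rfl | rfl)
      · exact Submodule.subset_span (by simp [hw])
      · change d w ∈ Q
        rw [hw, hd.apply_apply]
        exact Q.zero_mem
    exact this hx
  have hentry : ∀ i j, entry (π * d * skipMap R k) i j =
      entry d (skip k i) (skip k j) - a * entry d (skip k i) (k + 1) * w (skip k j) := by
    intro i j
    simp only [entry, Module.End.mul_apply, skipMap_stdE, hπ, cuspProj_apply]
  refine ⟨π * d * skipMap R k, ⟨?_, ?_⟩, ?_, ⟨⟨?_, ?_⟩, ?_⟩, ?_⟩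
  · intro i j hij
    by_contra hc
    apply hij
    rw [hentry]
    have hs : ∀ j, skip k j < s ↔ j < s - 2 := by
      intro j; unfold skip; split_ifs <;> omega
    have h1 : entry d (skip k i) (skip k j) = 0 := hd.entry_eq_zero (by rw [skip_lt_skip, hs]; exact hc)
    have h2 : entry d (skip k i) (k + 1) * w (skip k j) = 0 := by
      by_cases h3 : skip k i < k + 1
      · rw [hwk (skip k j), mul_zero]
        rintro ⟨h4, h5⟩
        have := skip_ne k i
        exact hc ⟨skip_lt_skip.1 (by omega : skip k i < skip k j), (hs j).1 h5⟩
      · rw [hd.entry_eq_zero (by omega), zero_mul]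
    rw [h1, mul_assoc, h2, mul_zero, sub_zero]
  · -- `π d` only depends on the class modulo `Q`, so that `d ∘ d = 0` descends to the quotient.
    refine LinearMap.ext fun x => ?_
    change π (d (skipMap R k (π (d (skipMap R k x))))) = 0
    set y := d (skipMap R k x) with hy
    have h1 : d (skipMap R k (π y)) = d (skipMap R k (π y) - y) := by
      rw [map_sub, hy, hd.apply_apply, sub_zero]
    rw [h1]
    exact hQπ _ (hdQ _ (hsub y))
  · intro i j hij
    have hlt : ∀ i, skip k i < s → ν' i = ν (skip k i) := fun i hi => hν i (by
      unfold skip at hi; split_ifs at hi <;> omega)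
    rw [hentry] at hij
    by_cases h1 : entry d (skip k i) (skip k j) = 0
    · rw [h1] at hij
      have h2 : entry d (skip k i) (k + 1) ≠ 0 := fun h => hij (by rw [h]; ring)
      have h3 : entry d k (skip k j) ≠ 0 := fun h => hij (by
        have : w (skip k j) = 0 := h
        rw [this]; ring)
      have b2 := hd.1 _ _ h2
      have b3 := hd.1 _ _ h3
      rw [hlt i (by omega), hlt j (by omega), hg _ _ h3, hcusp, hg _ _ h2]
      ring
    · have b1 := hd.1 _ _ h1
      rw [hlt i (by omega), hlt j (by omega), hg _ _ h1]
  · intro x y hxy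
    have : skipMap R k x - skipMap R k y ∈ Q := (Submodule.Quotient.eq Q).1 hxy
    have := hQπ _ this
    rw [map_sub, hπskip, hπskip, sub_eq_zero] at this
    exact this
  · intro z
    obtain ⟨y, rfl⟩ := Q.mkQ_surjective z
    exact ⟨π y, (Submodule.Quotient.eq Q).2 (hsub y)⟩
  · refine LinearMap.ext fun x => ?_
    exact (Submodule.Quotient.eq Q).2 (hsub _)
  · rintro p q rfl
    rw [hentry]
    have h1 : skip (2 * q) (2 * p + 1) = skip (2 * q) (2 * p) + 1 := by
      unfold skip; split_ifs <;> omega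
    rw [h1]
    have h2 : entry d (skip (2 * q) (2 * p)) (2 * q + 1) * w (skip (2 * q) (2 * p) + 1) = 0 := by
      by_cases h3 : skip (2 * q) (2 * p) < 2 * q + 1
      · rw [hwk _ (by unfold skip at *; split_ifs at * <;> omega), mul_zero]
      · rw [hd.entry_eq_zero (by omega), zero_mul]
    rw [mul_assoc, h2, mul_zero, sub_zero]

end Differentials

/-! ### Nearly plat diagrams and Maslov potentials -/

namespace FrontDiagram

variable {D : FrontDiagram}

theorem strands_zero : D.strands 0 = 0 := rfl

theorem strands_succ {l : ℕ} {e : FrontEvent} (h : D.events[l]? = some e) :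
    D.strands (l + 1) = e.after (D.strands l) := by
  simp [strands, strandCount, List.take_add_one, h]

theorem lt_length_of_event {l : ℕ} {e : FrontEvent} (h : D.events[l]? = some e) :
    l < D.events.length := (List.getElem?_eq_some_iff.1 h).1

theorem crossing_lt {l k : ℕ} (h : D.events[l]? = some (.crossing k)) : k + 1 < D.strands l :=
  D.fits l _ h

theorem rightCusp_lt {l k : ℕ} (h : D.events[l]? = some (.rightCusp k)) : k + 1 < D.strands l :=
  D.fits l _ h

/-- In a nearly plat diagram there is a gap `b` such that exactly the events to the right of it are
right cusps, these join the strands `2p` and `2p + 1`, and only left cusps precede a left cusp. -/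
theorem IsNearlyPlat.exists_rightPart (hD : D.IsNearlyPlat) : ∃ b : ℕ,
    (∀ (l : ℕ) (e : FrontEvent), D.events[l]? = some e → b ≤ l → ∃ p, e = .rightCusp (2 * p)) ∧
    (∀ l k : ℕ, D.events[l]? = some (.rightCusp k) → b ≤ l) ∧
    (∀ l k : ℕ, D.events[l + 1]? = some (.leftCusp k) →
      ∃ k', D.events[l]? = some (.leftCusp k')) := by
  obtain ⟨ls, xs, rs, h⟩ := hD
  refine ⟨ls.length + xs.length, ?_, ?_, ?_⟩
  · intro l e he hl
    rw [h, List.getElem?_append_right (by simpa using hl), List.getElem?_map] at he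
    obtain ⟨p, -, rfl⟩ := Option.map_eq_some_iff.1 he
    exact ⟨p, rfl⟩
  · intro l k he
    by_contra hl
    rw [h, List.getElem?_append_left (by simpa using hl)] at he
    rcases lt_or_ge l ls.length with h1 | h1
    · rw [List.getElem?_append_left (by simpa using h1), List.getElem?_map] at he
      obtain ⟨p, -, hp⟩ := Option.map_eq_some_iff.1 he
      cases hp
    · rw [List.getElem?_append_right (by simpa using h1), List.getElem?_map] at he
      obtain ⟨p, -, hp⟩ := Option.map_eq_some_iff.1 he
      cases hp
  · intro l k he
    have h1 : l + 1 < ls.length := by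
      by_contra h1
      rw [h, List.append_assoc, List.getElem?_append_right (by simpa using h1)] at he
      rcases List.mem_append.1 (List.mem_of_getElem? he) with h2 | h2
      · obtain ⟨p, -, hp⟩ := List.mem_map.1 h2
        cases hp
      · obtain ⟨p, -, hp⟩ := List.mem_map.1 h2
        cases hp
    refine ⟨2 * ls[l], ?_⟩
    rw [h, List.append_assoc, List.getElem?_append_left (by simp; omega), List.getElem?_map,
      List.getElem?_eq_getElem (by omega)]
    rfl

variable {M : ℕ}

/-- The Maslov potential modulo `m` of the strands of gap `l`. -/
def MaslovPotential.deg (μ : D.MaslovPotential M) (m l i : ℕ) : ZMod m := (μ.val (l, i)).cast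

variable {μ : D.MaslovPotential M} {m : ℕ}

theorem isGradedCrossing_iff (hm : m ∣ M) {l k : ℕ} (h : D.events[l]? = some (.crossing k)) :
    D.IsGradedCrossing μ m l ↔ μ.deg m l k = μ.deg m l (k + 1) := by
  unfold IsGradedCrossing MaslovPotential.deg
  constructor
  · rintro ⟨k', hk', h0⟩
    rw [h] at hk'
    cases hk'
    rwa [ZMod.cast_sub hm, sub_eq_zero] at h0
  · intro h0
    exact ⟨k, h, by rw [ZMod.cast_sub hm, h0, sub_self]⟩

theorem MaslovPotential.deg_crossing {l k i : ℕ} (h : D.events[l]? = some (.crossing k))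
    (hi : i < D.strands l) : μ.deg m (l + 1) (Equiv.swap k (k + 1) i) = μ.deg m l i := by
  unfold MaslovPotential.deg
  rw [μ.val_continues _ _ (Continues.crossing h hi)]

theorem MaslovPotential.deg_rightCusp {l k i : ℕ} (h : D.events[l]? = some (.rightCusp k))
    (hi : i < D.strands (l + 1)) : μ.deg m (l + 1) i = μ.deg m l (skip k i) := by
  unfold MaslovPotential.deg
  rw [μ.val_continues _ _ (Continues.rightCusp h hi)]

theorem MaslovPotential.deg_cusp (hm : m ∣ M) {l k : ℕ} (h : D.events[l]? = some (.rightCusp k)) :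
    μ.deg m l k = μ.deg m l (k + 1) + 1 := by
  unfold MaslovPotential.deg
  rw [μ.val_cusp _ _ (Cusp.right h), ZMod.cast_add hm, ZMod.cast_one hm]

/-- An `m`-graded handleslide in gap `l` may have the endpoints `a` and `b`. -/
def Admissible (μ : D.MaslovPotential M) (m l a b : ℕ) : Prop :=
  a < b ∧ b < D.strands l ∧ μ.deg m l a = μ.deg m l b

theorem Admissible.trans {l a b c : ℕ} (h1 : Admissible μ m l a b) (h2 : Admissible μ m l b c) :
    Admissible μ m l a c :=
  ⟨h1.1.trans h2.1, h2.2.1, h1.2.2.trans h2.2.2⟩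

theorem Admissible.crossing {l k a b : ℕ} (h : D.events[l]? = some (.crossing k))
    (hab : Admissible μ m l a b) (hne : ¬ (a = k ∧ b = k + 1)) :
    Admissible μ m (l + 1) (Equiv.swap k (k + 1) a) (Equiv.swap k (k + 1) b) := by
  refine ⟨swap_lt_swap hab.1 hne, ?_, ?_⟩
  · rw [strands_succ h]
    exact (swap_lt_iff (crossing_lt h)).2 hab.2.1
  · rw [MaslovPotential.deg_crossing h (hab.1.trans hab.2.1),
      MaslovPotential.deg_crossing h hab.2.1, hab.2.2]

end FrontDiagram

open FrontDiagram

/-! ### Morse complex sequences with given handleslides -/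

section Construction

variable {R : Type*}

theorem AllEnds.take {P : ℕ → ℕ → Prop} {L : List (Handleslide R)} (hL : AllEnds P L) (p : ℕ) :
    AllEnds P (L.take p) := fun g hg => hL g (List.mem_of_mem_take hg)

variable [CommRing R]

/-- The differential to the right of the handleslides `L` (listed from left to right), if `d` is the
one to their left. -/
noncomputable def slidesConj (L : List (Handleslide R)) (d : Module.End R (ℕ →₀ R)) :
    Module.End R (ℕ →₀ R) :=
  L.foldl (fun d h => slideConj h d) d

theorem IsTriangularDifferential.slidesConj {s : ℕ} {L : List (Handleslide R)}
    (hL : AllEnds (fun a b => a < b ∧ b < s) L) {d : Module.End R (ℕ →₀ R)}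
    (hd : IsTriangularDifferential s d) : IsTriangularDifferential s (slidesConj L d) := by
  induction L generalizing d with
  | nil => exact hd
  | cons g L ih =>
    rw [allEnds_cons] at hL
    exact ih hL.2 (hd.slideConj hL.1.1 hL.1.2)

theorem LowersDegree.slidesConj {m : ℕ} {ν : ℕ → ZMod m} {L : List (Handleslide R)}
    (hL : AllEnds (fun a b => ν a = ν b) L) {d : Module.End R (ℕ →₀ R)}
    (hd : LowersDegree ν d) : LowersDegree ν (slidesConj L d) := by
  induction L generalizing d with
  | nil => exact hd
  | cons g L ih =>
    rw [allEnds_cons] at hL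
    exact ih hL.2 (LowersDegree.slideConj hd hL.1)

/-- A Morse complex sequence with prescribed handleslides is constructed from left to right, if the
differential can be continued past each event while an invariant is kept. -/
theorem exists_MCS_of_step {D : FrontDiagram} {pts : D.MarkedPoints}
    (slides : ℕ → List (Handleslide R))
    (hslides : ∀ l ≤ D.events.length, AllEnds (fun a b => a < b ∧ b < D.strands l) (slides l))
    (Inv : ℕ → Module.End R (ℕ →₀ R) → Prop)
    (htri : ∀ l d, Inv l d → IsTriangularDifferential (D.strands l) d)
    {d₀ : Module.End R (ℕ →₀ R)} (h₀ : Inv 0 d₀)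
    (hstep : ∀ l e d, D.events[l]? = some e → Inv l d →
      ∃ d', EventCondition (l ∈ pts.cusps) (slidesConj (slides l) d) d' e ∧ Inv (l + 1) d') :
    ∃ A : MCS R D pts, A.slides = slides ∧
      (∀ l ≤ D.events.length, Inv l (A.d l 0)) ∧
      ∀ l p, A.d l p = slidesConj ((slides l).take p) (A.d l 0) := by
  have hex : ∀ l d, ∃ d', ∀ e, D.events[l]? = some e → Inv l d →
      EventCondition (l ∈ pts.cusps) (slidesConj (slides l) d) d' e ∧ Inv (l + 1) d' := by
    intro l d
    by_cases h : ∃ e, D.events[l]? = some e ∧ Inv l d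
    · obtain ⟨e, he, hI⟩ := h
      obtain ⟨d', hd'⟩ := hstep l e d he hI
      refine ⟨d', fun e' he' _ => ?_⟩
      rw [he] at he'
      cases he'
      exact hd'
    · exact ⟨d, fun e he hI => (h ⟨e, he, hI⟩).elim⟩
  choose f hf using hex
  let E : ℕ → Module.End R (ℕ →₀ R) := fun l => Nat.rec d₀ f l
  have hE : ∀ l ≤ D.events.length, Inv l (E l) := by
    intro l
    induction l with
    | zero => exact fun _ => h₀
    | succ l ih =>
      intro hl
      exact (hf l (E l) _ (List.getElem?_eq_getElem (by omega)) (ih (by omega))).2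
  refine ⟨{ slides := slides
            slides_valid := hslides
            d := fun l p => slidesConj ((slides l).take p) (E l)
            differential := fun l hl p _ => (htri l _ (hE l hl)).slidesConj ((hslides l hl).take p)
            slide_iso := ?_
            event_condition := ?_ }, rfl, hE, fun l p => rfl⟩
  · intro l hl p h hp
    have h1 := hslides l hl h (List.mem_of_getElem? hp)
    have h2 : slidesConj ((slides l).take (p + 1)) (E l) =
        slideConj h (slidesConj ((slides l).take p) (E l)) := by
      simp [slidesConj, List.take_add_one, hp]
    rw [h2]
    exact isChainIso_slideConj h1.1.ne _
  · intro l e he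
    have := (hf l (E l) e he (hE l (lt_length_of_event he).le)).1
    simpa [slidesConj] using this

end Construction

/-! ### The construction of `Φ(C)` -/

namespace MCS

variable {F : Type*} [Field F] {D : FrontDiagram} {pts : D.MarkedPoints} {C : MCS F D pts}
  {ρ : NormalRuling D} {M : ℕ} {μ : D.MaslovPotential M} {m : ℕ}

/-- The handleslides of an SR-form MCS in gap `l` that belong to the event to the left of the gap. -/
noncomputable def startSlides (C : MCS F D pts) (ρ : NormalRuling D) {M : ℕ}
    (μ : D.MaslovPotential M) (m : ℕ) : ℕ → List (Handleslide F)
  | 0 => []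
  | l + 1 => C.postSlides ρ μ m l

/-- The differential of an SR-form MCS in gap `l` between the handleslides that belong to the event
on the left and the ones that belong to the event on the right. -/
noncomputable def midDiff (C : MCS F D pts) (ρ : NormalRuling D) {M : ℕ}
    (μ : D.MaslovPotential M) (m l : ℕ) : Module.End F (ℕ →₀ F) :=
  C.d l (C.startSlides ρ μ m l).length

theorem postSlides_leftCusp {l k : ℕ} (h : D.events[l]? = some (.leftCusp k)) :
    C.postSlides ρ μ m l = [] := by simp [postSlides, h]

theorem postSlides_rightCusp {l k : ℕ} (h : D.events[l]? = some (.rightCusp k)) :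
    C.postSlides ρ μ m l = [] := by simp [postSlides, h]

theorem preSlides_leftCusp {l k : ℕ} (h : D.events[l]? = some (.leftCusp k)) :
    C.preSlides ρ μ m l = [] := by simp [preSlides, h]

theorem phiSlides_leftCusp {l k : ℕ} (h : D.events[l]? = some (.leftCusp k)) :
    C.phiSlides ρ μ m l = [] := by simp [phiSlides, h]

theorem preSlides_eq {l k : ℕ}
    (h : D.events[l]? = some (.crossing k) ∨ D.events[l]? = some (.rightCusp k)) :
    (C.preSlides ρ μ m l = [] ∧ C.preCoeff ρ μ m k l = 0) ∨
      C.preSlides ρ μ m l = [⟨k, k + 1, C.preCoeff ρ μ m k l⟩] := by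
  unfold preCoeff
  rcases h with h | h <;> simp only [preSlides, h] <;> split_ifs <;> simp [slideCoeff]

namespace IsSRForm

theorem slides_eq (hC : C.IsSRForm ρ μ m) {l : ℕ} (hl : l ≤ D.events.length) :
    C.slides l = C.startSlides ρ μ m l ++ C.preSlides ρ μ m l := by
  cases l with
  | succ l => exact hC.slides_succ l (by omega)
  | zero =>
    rw [hC.slides_zero]
    -- There are no strands in gap `0`, hence no crossing or right cusp to the right of it.
    have hpre : C.preSlides ρ μ m 0 = [] := by
      unfold preSlides
      split
      · exact absurd (crossing_lt (by assumption)) (by simp [strands_zero])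
      · exact absurd (rightCusp_lt (by assumption)) (by simp [strands_zero])
      · rfl
    simp [startSlides, hpre]

theorem allEnds_slides (hC : C.IsSRForm ρ μ m) {l : ℕ} (hl : l ≤ D.events.length) :
    AllEnds (Admissible μ m l) (C.slides l) := fun h hh =>
  ⟨(C.slides_valid l hl h hh).1, (C.slides_valid l hl h hh).2, hC.graded.2 l hl h hh⟩

theorem lowersDegree (hC : C.IsSRForm ρ μ m) {l p : ℕ} (hl : l ≤ D.events.length) (hp : p ≤ (C.slides l).length) :
    LowersDegree (μ.deg m l) (C.d l p) := fun i j => hC.graded.1 l hl p hp i j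

theorem startSlides_length_le (hC : C.IsSRForm ρ μ m) {l : ℕ} (hl : l ≤ D.events.length) :
    (C.startSlides ρ μ m l).length ≤ (C.slides l).length := by
  rw [hC.slides_eq hl, List.length_append]; omega

theorem midDiff_tri (hC : C.IsSRForm ρ μ m) {l : ℕ} (hl : l ≤ D.events.length) :
    IsTriangularDifferential (D.strands l) (C.midDiff ρ μ m l) :=
  C.differential l hl _ (hC.startSlides_length_le hl)

/-- The handleslide immediately to the left of an event, possibly a trivial one. -/
theorem d_length_eq (hC : C.IsSRForm ρ μ m) {l k : ℕ}
    (h : D.events[l]? = some (.crossing k) ∨ D.events[l]? = some (.rightCusp k)) :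
    C.d l (C.slides l).length =
      slideConj ⟨k, k + 1, C.preCoeff ρ μ m k l⟩ (C.midDiff ρ μ m l) := by
  have hl : l ≤ D.events.length := by
    rcases h with h | h <;> exact (lt_length_of_event h).le
  have hs := hC.slides_eq hl
  rcases preSlides_eq (C := C) (ρ := ρ) (μ := μ) (m := m) h with ⟨h1, h2⟩ | h1
  · rw [h1, List.append_nil] at hs
    rw [hs, h2, slideConj]
    simp [slideMap_zero, midDiff]
  · rw [h1] at hs
    have := C.slide_iso l hl (C.startSlides ρ μ m l).length ⟨k, k + 1, C.preCoeff ρ μ m k l⟩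
      (by rw [hs]; simp)
    rw [midDiff, ← this.eq_slideConj (by simp), hs]
    simp

theorem d_length_leftCusp (hC : C.IsSRForm ρ μ m) {l k : ℕ} (h : D.events[l]? = some (.leftCusp k)) :
    C.d l (C.slides l).length = C.midDiff ρ μ m l := by
  rw [hC.slides_eq (lt_length_of_event h).le, preSlides_leftCusp h, List.append_nil, midDiff]

end IsSRForm

/-- Incorporating the first handleslides `L` of a gap into a collection that intertwines `d` with the
differentials of `C`. -/
theorem slideProd_foldl_incorporate {P : ℕ → ℕ → Prop} (hP : ∀ a b c, P a b → P b c → P a c)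
    (hlt : ∀ a b, P a b → a < b) {l : ℕ} (hl : l ≤ D.events.length)
    (hS : AllEnds P (C.slides l)) {V : List (Handleslide F)} (hV : IsOrdered V) (hVP : AllEnds P V)
    {d : Module.End F (ℕ →₀ F)} (hd : slideProd V * d = C.d l 0 * slideProd V)
    (L L' : List (Handleslide F)) (hL : C.slides l = L ++ L') :
    IsOrdered (L.foldl (fun V h => incorporate h V) V) ∧
      AllEnds P (L.foldl (fun V h => incorporate h V) V) ∧
      slideProd (L.foldl (fun V h => incorporate h V) V) * d =
        C.d l L.length * slideProd (L.foldl (fun V h => incorporate h V) V) := by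
  induction L using List.reverseRecOn generalizing L' with
  | nil => exact ⟨hV, hVP, hd⟩
  | append_singleton L h ih =>
    obtain ⟨ih1, ih2, ih3⟩ := ih (h :: L') (by rw [hL]; simp)
    have hh : P h.top h.bot := hS h (by rw [hL]; simp)
    have hiso := (C.slide_iso l hl L.length h (by rw [hL]; simp)).2
    change slideMap h * C.d l L.length = C.d l (L.length + 1) * slideMap h at hiso
    rw [List.foldl_append, List.foldl_cons, List.foldl_nil, List.length_append, List.length_singleton]
    refine ⟨ih1.incorporate (hlt _ _ hh) (ih2.mono hlt), ih2.incorporate hP hh, ?_⟩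
    rw [slideProd_incorporate (hlt _ _ hh) ih1 (ih2.mono hlt), mul_assoc, ih3, ← mul_assoc, hiso,
      mul_assoc]

/-- The handleslides of `Φ(C)` are `m`-graded.  At a right cusp this is so as `m = 1`. -/
theorem phiSlides_admissible (hm : m ∣ M) (l : ℕ) :
    AllEnds (Admissible μ m l) (C.phiSlides ρ μ m l) := by
  unfold phiSlides
  split
  · rename_i k h
    split_ifs with hg
    · simpa [AllEnds] using ⟨by simp, crossing_lt h, (isGradedCrossing_iff hm h).1 hg⟩
    · exact AllEnds.nil
  · rename_i k h
    split_ifs with hg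
    · subst hg
      simpa [AllEnds] using ⟨by simp, rightCusp_lt h, Subsingleton.elim _ _⟩
    · exact AllEnds.nil
  · exact AllEnds.nil

/-- The collection that arrives at an event preceded only by left cusps is empty. -/
theorem phiCollection_eq_nil
    (hD : ∀ l k, D.events[l + 1]? = some (.leftCusp k) → ∃ k', D.events[l]? = some (.leftCusp k'))
    {l k : ℕ} (h : D.events[l]? = some (.leftCusp k)) : C.phiCollection ρ μ m l = [] := by
  cases l with
  | zero => rfl
  | succ l =>
    obtain ⟨k', hk'⟩ := hD l k h
    simp [phiCollection, hk']

/-- The step of the construction at a crossing: the moved collection still intertwines the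
differential of `Φ(C)` with the one of `C`. -/
theorem exists_crossing_step (hm : m ∣ M) (hρ : ρ.IsGraded μ m) (hC : C.IsSRForm ρ μ m) {l k : ℕ}
    (h : D.events[l]? = some (.crossing k)) {d : Module.End F (ℕ →₀ F)}
    (htri : IsTriangularDifferential (D.strands l) d) (hdeg : LowersDegree (μ.deg m l) d)
    (hord : IsOrdered (C.phiCollection ρ μ m l))
    (hadm : AllEnds (Admissible μ m l) (C.phiCollection ρ μ m l))
    (hd : slideProd (C.phiCollection ρ μ m l) * d =
      C.midDiff ρ μ m l * slideProd (C.phiCollection ρ μ m l)) :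
    ∃ d', EventCondition (l ∈ pts.cusps) (slidesConj (C.phiSlides ρ μ m l) d) d' (.crossing k) ∧
      IsTriangularDifferential (D.strands (l + 1)) d' ∧ LowersDegree (μ.deg m (l + 1)) d' ∧
      IsOrdered (C.phiCollection ρ μ m (l + 1)) ∧
      AllEnds (Admissible μ m (l + 1)) (C.phiCollection ρ μ m (l + 1)) ∧
      slideProd (C.phiCollection ρ μ m (l + 1)) * d' =
        C.midDiff ρ μ m (l + 1) * slideProd (C.phiCollection ρ μ m (l + 1)) := by
  have hlen := lt_length_of_event h
  have hk := crossing_lt h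
  obtain ⟨hev1, hev2, hev3⟩ := C.event_condition l _ h
  have htrans : ∀ a b c, Admissible μ m l a b → Admissible μ m l b c → Admissible μ m l a c :=
    fun _ _ _ => Admissible.trans
  set V := C.phiCollection ρ μ m l with hVdef
  set d₁ := slidesConj (C.phiSlides ρ μ m l) d with hd₁
  set Cl := C.d l (C.slides l).length with hCl
  -- `W` is the collection that is slid past the crossing.
  obtain ⟨W, hW1, hW2, hW3, hW4, hW5⟩ : ∃ W, IsOrdered W ∧ AllEnds (Admissible μ m l) W ∧
      AllEnds (fun a b => ¬ (a = k ∧ b = k + 1)) W ∧ slideProd W * d₁ = Cl * slideProd W ∧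
      C.phiCollection ρ μ m (l + 1) = (C.postSlides ρ μ m l).foldl (fun V h => incorporate h V)
        (passCrossing k W) := by
    have hCl' := hC.d_length_eq (ρ := ρ) (μ := μ) (m := m) (Or.inl h)
    rw [← hCl] at hCl'
    by_cases hg : D.IsGradedCrossing μ m l
    · set c := C.preCoeff ρ μ m k l with hc
      set V₁ := incorporate ⟨k, k + 1, c⟩ V with hV₁
      have hkadm : Admissible μ m l k (k + 1) := ⟨by simp, hk, (isGradedCrossing_iff hm h).1 hg⟩
      have hV₁ord : IsOrdered V₁ := hord.incorporate (by simp) (hadm.mono fun _ _ => And.left)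
      have hV₁adm : AllEnds (Admissible μ m l) V₁ := hadm.incorporate htrans hkadm
      refine ⟨removeSlide k (k + 1) V₁, hV₁ord.removeSlide (hV₁adm.mono fun _ _ => And.left),
        hV₁adm.removeSlide htrans, removeSlide_allEnds_ne hV₁ord (hV₁adm.mono fun _ _ => And.left),
        ?_, ?_⟩
      · set g : Handleslide F := ⟨k, k + 1, slideCoeff k (k + 1) V₁⟩ with hgdef
        have hd₁' : d₁ = slideConj g d := by
          rw [hd₁, phiSlides, h]
          simp [hg, slidesConj, hgdef, hV₁, hc, hVdef]
        have hgne : g.top ≠ g.bot := by simp [hgdef]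
        have h1 := slideProd_removeSlide (a := k) (b := k + 1) hV₁ord
          (hV₁adm.mono fun _ _ => And.left)
        have h2 : slideProd V₁ = slideMap ⟨k, k + 1, c⟩ * slideProd V :=
          slideProd_incorporate (by simp) hord (hadm.mono fun _ _ => And.left)
        refine (slideMap_isUnit hgne).mul_right_cancel ?_
        rw [mul_assoc, hd₁', slideConj_mul hgne, ← mul_assoc, mul_assoc Cl, ← h1, h2, mul_assoc, hd,
          hCl', ← mul_assoc, ← mul_assoc, slideConj_mul (by simp)]
      · simp [phiCollection, h, hg, hV₁, hc, hVdef]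
    · have hns : ¬ (ρ.IsSwitch l ∨ ρ.IsGradedReturn μ m l) := fun hn =>
        hg (hn.elim (hρ l) And.right)
      rw [not_or] at hns
      have hpre : C.preCoeff ρ μ m k l = 0 := by simp [preCoeff, preSlides, h, hns, slideCoeff]
      have hpost : C.postSlides ρ μ m l = [] := by simp [postSlides, h, hns]
      refine ⟨V, hord, hadm, hadm.mono ?_, ?_, ?_⟩
      · rintro a b hab ⟨rfl, rfl⟩
        exact hg ((isGradedCrossing_iff hm h).2 hab.2.2)
      · have hd₁' : d₁ = d := by
          rw [hd₁, phiSlides, h]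
          simp [hg, slidesConj]
        have hCl'' : Cl = C.midDiff ρ μ m l := by
          rw [hCl', hpre, slideConj]
          simp [slideMap_zero]
        rw [hd₁', hCl'', hd]
      · simp [phiCollection, h, hg, hpost, hVdef]
  have hphi := phiSlides_admissible (C := C) (ρ := ρ) (μ := μ) hm l
  have htri₁ : IsTriangularDifferential (D.strands l) d₁ :=
    htri.slidesConj (hphi.mono fun _ _ h => ⟨h.1, h.2.1⟩)
  have hdeg₁ : LowersDegree (μ.deg m l) d₁ := LowersDegree.slidesConj (hphi.mono fun _ _ h => h.2.2) hdeg
  have hentry : entry d₁ k (k + 1) = 0 := by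
    rw [entry_adjacent_of_slideProd (hW2.mono fun _ _ h => ⟨h.1, h.2.1⟩)
      (C.differential l hlen.le _ le_rfl) hW4, hev1]
  have hW6 : AllEnds (fun a b => a < b ∧ ¬ (a = k ∧ b = k + 1)) W :=
    (hW2.mono fun _ _ => And.left).and hW3
  have hadm' : AllEnds (Admissible μ m (l + 1)) (passCrossing k W) :=
    AllEnds.passCrossing (fun a b hab => hab.1.crossing h hab.2) (hW2.and hW3)
  have hcomm : slideProd (passCrossing k W) * (swapMap F k * d₁ * swapMap F k) =
      C.d (l + 1) 0 * slideProd (passCrossing k W) := by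
    have hsw : swapMap F k * Cl = C.d (l + 1) 0 * swapMap F k := hev3.2
    rw [slideProd_passCrossing hW1 hW6]
    calc swapMap F k * slideProd W * swapMap F k * (swapMap F k * d₁ * swapMap F k)
        = swapMap F k * slideProd W * (swapMap F k * swapMap F k) * d₁ * swapMap F k := by
          simp only [mul_assoc]
      _ = swapMap F k * (slideProd W * d₁) * swapMap F k := by
          rw [swapMap_mul_self, mul_one]; simp only [mul_assoc]
      _ = (swapMap F k * Cl) * slideProd W * swapMap F k := by rw [hW4]; simp only [mul_assoc]
      _ = _ := by rw [hsw]; simp only [mul_assoc]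
  obtain ⟨k1, k2, k3⟩ := slideProd_foldl_incorporate (C := C) (P := Admissible μ m (l + 1))
    (fun _ _ _ => Admissible.trans) (fun _ _ => And.left) (by omega : l + 1 ≤ D.events.length)
    (hC.allEnds_slides (by omega)) (isOrdered_passCrossing k W) hadm' hcomm _ _
    (hC.slides_succ l hlen)
  rw [← hW5] at k1 k2 k3
  have hs : D.strands (l + 1) = D.strands l := strands_succ h
  refine ⟨swapMap F k * d₁ * swapMap F k, ⟨hentry, ?_, isChainIso_swapMap k d₁⟩, ?_, ?_, k1, k2, k3⟩
  · rw [entry_swapMap, Equiv.swap_apply_left, Equiv.swap_apply_right, htri₁.entry_eq_zero (by omega)]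
  · rw [hs]
    exact htri₁.swapMap hk hentry
  · exact LowersDegree.swapMap htri₁ hdeg₁ fun i hi => MaslovPotential.deg_crossing h hi

/-- The step of the construction at a right cusp.  Here only the coefficients of the differentials
of `Φ(C)` and `C` at the strands of the remaining right cusps are compared. -/
theorem exists_rightCusp_step (hm : m ∣ M) (hC : C.IsSRForm ρ μ m) {l q : ℕ}
    (h : D.events[l]? = some (.rightCusp (2 * q))) {d : Module.End F (ℕ →₀ F)}
    (htri : IsTriangularDifferential (D.strands l) d) (hdeg : LowersDegree (μ.deg m l) d)
    (hd : ∀ k, Even k → entry d k (k + 1) = entry (C.midDiff ρ μ m l) k (k + 1)) :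
    ∃ d', EventCondition (l ∈ pts.cusps) (slidesConj (C.phiSlides ρ μ m l) d) d'
        (.rightCusp (2 * q)) ∧
      IsTriangularDifferential (D.strands (l + 1)) d' ∧ LowersDegree (μ.deg m (l + 1)) d' ∧
      ∀ k, Even k → entry d' k (k + 1) = entry (C.midDiff ρ μ m (l + 1)) k (k + 1) := by
  have hlen := lt_length_of_event h
  have hk := rightCusp_lt h
  obtain ⟨hev1, hev2, hev3⟩ := C.event_condition l _ h
  have hphi := phiSlides_admissible (C := C) (ρ := ρ) (μ := μ) hm l
  set d₁ := slidesConj (C.phiSlides ρ μ m l) d with hd₁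
  set Cl := C.d l (C.slides l).length with hCl
  have hCltri : IsTriangularDifferential (D.strands l) Cl := C.differential l hlen.le _ le_rfl
  have htri₁ : IsTriangularDifferential (D.strands l) d₁ :=
    htri.slidesConj (hphi.mono fun _ _ h => ⟨h.1, h.2.1⟩)
  have hdeg₁ : LowersDegree (μ.deg m l) d₁ := LowersDegree.slidesConj (hphi.mono fun _ _ h => h.2.2) hdeg
  have hentry : ∀ k, Even k → entry d₁ k (k + 1) = entry Cl k (k + 1) := by
    intro k hkev
    have h1 : entry d₁ k (k + 1) = entry d k (k + 1) := by
      rw [hd₁, phiSlides, h]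
      simp only
      split_ifs
      · exact entry_slideConj_adjacent htri (by simp) k
      · rfl
    rw [h1, hd k hkev, hCl, hC.d_length_eq (Or.inr h),
      entry_slideConj_adjacent (hC.midDiff_tri hlen.le) (by simp) k]
  have hs : D.strands (l + 1) = D.strands l - 2 := strands_succ h
  have hunit : IsUnit (entry Cl (2 * q) (2 * q + 1)) := by
    by_cases hmk : l ∈ pts.cusps
    · exact hev1 hmk
    · rw [hev2 hmk]; exact isUnit_one.neg
  have hν : ∀ i < D.strands l - 2, μ.deg m (l + 1) i = μ.deg m l (skip (2 * q) i) := fun i hi =>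
    MaslovPotential.deg_rightCusp h (by rw [hs]; exact hi)
  obtain ⟨d', t1, t2, t3, t4⟩ := exists_isCuspIso htri₁ hk
    (by rw [hentry _ (even_two_mul q)]; exact hunit) hdeg₁ hν (MaslovPotential.deg_cusp hm h)
  obtain ⟨c', -, -, s3, s4⟩ := exists_isCuspIso hCltri hk hunit
    (hC.lowersDegree hlen.le le_rfl) hν (MaslovPotential.deg_cusp hm h)
  refine ⟨d', ⟨?_, ?_, t3⟩, by rwa [hs], t2, ?_⟩
  · rw [hentry _ (even_two_mul q)]; exact hev1
  · rw [hentry _ (even_two_mul q)]; exact hev2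
  · intro k hkev
    obtain ⟨p, rfl⟩ := hkev.exists_two_nsmul
    have hmid : C.midDiff ρ μ m (l + 1) = c' := by
      rw [s3.unique hev3, midDiff, startSlides, postSlides_rightCusp h]
      rfl
    have hev : Even (skip (2 * q) (2 * p)) := by
      unfold skip
      split_ifs
      · exact even_two_mul p
      · exact (even_two_mul p).add even_two
    rw [smul_eq_mul, hmid, t4 p q rfl, s4 p q rfl, hentry _ hev]

/-- The handleslides of `Φ(C)` are those of an A-form sequence.  Up to the gap `b` after the last
crossing, its differential is intertwined with the one of `C` by the travelling collection;
afterwards only the coefficients at the strands of the right cusps are compared. -/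
theorem exists_isPhi (hD : D.IsNearlyPlat) (hm : m ∣ M) (hρ : ρ.IsGraded μ m)
    (hC : C.IsSRForm ρ μ m) : ∃ A : MCS F D pts, C.IsPhi ρ μ m A := by
  obtain ⟨b, hb1, hb2, hb3⟩ := hD.exists_rightPart
  let Inv : ℕ → Module.End F (ℕ →₀ F) → Prop := fun l d =>
    IsTriangularDifferential (D.strands l) d ∧ LowersDegree (μ.deg m l) d ∧
    (l ≤ b → IsOrdered (C.phiCollection ρ μ m l) ∧
      AllEnds (Admissible μ m l) (C.phiCollection ρ μ m l) ∧
      slideProd (C.phiCollection ρ μ m l) * d =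
        C.midDiff ρ μ m l * slideProd (C.phiCollection ρ μ m l)) ∧
    (b < l → ∀ k, Even k → entry d k (k + 1) = entry (C.midDiff ρ μ m l) k (k + 1)) ∧
    (∀ l' k, l = l' + 1 → D.events[l']? = some (.leftCusp k) → d = C.d l 0)
  have hinit : Inv 0 (C.d 0 0) := by
    refine ⟨C.differential 0 (Nat.zero_le _) 0 (Nat.zero_le _),
      hC.lowersDegree (Nat.zero_le _) (Nat.zero_le _), fun _ => ?_, fun h => by omega,
      fun l' k h => by omega⟩
    simp [phiCollection, IsOrdered, AllEnds, slideProd, midDiff, startSlides]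
  have hstep : ∀ l e d, D.events[l]? = some e → Inv l d → ∃ d',
      EventCondition (l ∈ pts.cusps) (slidesConj (C.phiSlides ρ μ m l) d) d' e ∧
        Inv (l + 1) d' := by
    rintro l e d he ⟨i1, i2, i3, i4, -⟩
    have hlen := lt_length_of_event he
    cases e with
    | leftCusp k =>
      have hlb : l < b := by
        by_contra hlb
        obtain ⟨p, hp⟩ := hb1 l _ he (by omega)
        cases hp
      have hd : d = C.d l (C.slides l).length := by
        have := (i3 hlb.le).2.2
        rw [phiCollection_eq_nil hb3 he, slideProd_nil, one_mul, mul_one] at this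
        rw [this, hC.d_length_leftCusp he]
      refine ⟨C.d (l + 1) 0, ?_, C.differential _ hlen 0 (Nat.zero_le _),
        hC.lowersDegree hlen (Nat.zero_le _), fun _ => ?_, fun h => by omega, fun _ _ _ _ => rfl⟩
      · rw [phiSlides_leftCusp he, hd]
        exact C.event_condition l _ he
      · simp [phiCollection, he, IsOrdered, AllEnds, slideProd, midDiff, startSlides,
          postSlides_leftCusp he]
    | crossing k =>
      have hlb : l < b := by
        by_contra hlb
        obtain ⟨p, hp⟩ := hb1 l _ he (by omega)
        cases hp
      obtain ⟨j1, j2, j3⟩ := i3 hlb.le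
      obtain ⟨d', t1, t2, t3, t4⟩ := exists_crossing_step hm hρ hC he i1 i2 j1 j2 j3
      refine ⟨d', t1, t2, t3, fun _ => t4, fun h => by omega, ?_⟩
      rintro l' k' hl' h'
      cases hl'
      rw [he] at h'
      cases h'
    | rightCusp k =>
      have hbl := hb2 l k he
      obtain ⟨q, hq⟩ := hb1 l _ he hbl
      cases hq
      have hd : ∀ k, Even k → entry d k (k + 1) = entry (C.midDiff ρ μ m l) k (k + 1) := by
        rcases hbl.lt_or_eq with h | h
        · exact i4 h
        · obtain ⟨-, j2, j3⟩ := i3 h.ge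
          exact fun k _ => entry_adjacent_of_slideProd (j2.mono fun _ _ h => ⟨h.1, h.2.1⟩)
            (hC.midDiff_tri hlen.le) j3 k
      obtain ⟨d', t1, t2, t3, t4⟩ := exists_rightCusp_step hm hC he i1 i2 hd
      refine ⟨d', t1, t2, t3, fun h => by omega, fun _ => t4, ?_⟩
      rintro l' k' hl' h'
      cases hl'
      rw [he] at h'
      cases h'
  obtain ⟨A, hA1, hA2, hA3⟩ := exists_MCS_of_step (pts := pts) (C.phiSlides ρ μ m)
    (fun l _ => (phiSlides_admissible hm l).mono fun _ _ h => ⟨h.1, h.2.1⟩) Inv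
    (fun l d h => h.1) hinit hstep
  have hphi := fun l => phiSlides_admissible (C := C) (ρ := ρ) (μ := μ) hm l
  refine ⟨A, ⟨⟨⟨?_, ?_⟩, ?_, ?_, ?_, ?_, ?_, ?_⟩, fun l _ => by rw [hA1]⟩⟩
  · intro l hl p hp
    have : LowersDegree (μ.deg m l) (A.d l p) := by
      rw [hA3]
      exact LowersDegree.slidesConj (((hphi l).mono fun _ _ h => h.2.2).take p) (hA2 l hl).2.1
    exact this
  · intro l hl h hh
    rw [hA1] at hh
    exact (hphi l h hh).2.2
  · intro l k h
    rw [(hA2 (l + 1) (lt_length_of_event h)).2.2.2.2 l k rfl h]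
    exact hC.simple l k h
  · intro l k h hg
    rw [hA1]
    simp [phiSlides, h, hg]
  · intro l k h hg
    rw [hA1]
    simp [phiSlides, h, hg]
  · intro l k h hg
    rw [hA1]
    simp [phiSlides, h, hg]
  · intro l k h hg
    rw [hA1]
    simp [phiSlides, h, hg]
  · intro l k h
    rw [hA1, phiSlides_leftCusp h]

end MCS

/-! ### Standard differentials -/

section Standard

variable {F : Type*} [Field F]

/-- The differential on `s` strands with `d e_i = c_i e_{σ i}` if `i < σ i` and `d e_i = 0`
otherwise: the disks of a ruling with involution `σ` determine it up to the coefficients. -/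
noncomputable def stdDiff (s : ℕ) (σ : ℕ → ℕ) (c : ℕ → F) : Module.End F (ℕ →₀ F) :=
  Finsupp.linearCombination F fun i => if i < s ∧ i < σ i then c i • stdE F (σ i) else 0

variable {s k : ℕ} {σ σ' : ℕ → ℕ} {c c' : ℕ → F}

theorem stdDiff_stdE (i : ℕ) :
    stdDiff s σ c (stdE F i) = if i < s ∧ i < σ i then c i • stdE F (σ i) else 0 := by
  simp [stdDiff, stdE]

theorem stdDiff_upper {i j : ℕ} (hi : i < s) (hj : σ i = j) (hij : i < j) :
    stdDiff s σ c (stdE F i) = c i • stdE F j := by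
  rw [stdDiff_stdE, hj, if_pos ⟨hi, hij⟩]

theorem stdDiff_lower {i j : ℕ} (hj : σ i = j) (hij : j < i) :
    stdDiff s σ c (stdE F i) = 0 := by
  rw [stdDiff_stdE, hj, if_neg (by omega)]

theorem stdDiff_of_le {i : ℕ} (hi : s ≤ i) : stdDiff s σ c (stdE F i) = 0 := by
  rw [stdDiff_stdE, if_neg (by omega)]

theorem entry_stdDiff {i j : ℕ} (hi : i < s) (hj : σ i = j) (hij : i < j) :
    entry (stdDiff s σ c) i j = c i := by
  rw [entry, stdDiff_upper hi hj hij]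
  simp [stdE_apply]

/-- `σ` is a fixed-point free involution of `s` strands that does not pair the strands `k` and
`k + 1` of a crossing. -/
structure CrossingInvolution (s k : ℕ) (σ : ℕ → ℕ) : Prop where
  lt : ∀ i < s, σ i < s
  inv : ∀ i < s, σ (σ i) = i
  ne : ∀ i < s, σ i ≠ i
  hk : k + 1 < s
  hne : σ k ≠ k + 1

namespace CrossingInvolution

theorem ne_right (h : CrossingInvolution s k σ) : σ (k + 1) ≠ k := fun h' =>
  h.hne (by rw [← h.inv _ h.hk, h'])

theorem companions_ne (h : CrossingInvolution s k σ) : σ k ≠ σ (k + 1) := fun h' => by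
  have := h.hk
  have := congrArg σ h'
  rw [h.inv _ (by omega), h.inv _ h.hk] at this
  omega

/-- An endomorphism that fixes the basis vectors of all strands other than those of a crossing and
their companions intertwines standard differentials if it does so on these four strands. -/
theorem stdDiff_mul_eq (h : CrossingInvolution s k σ) {T : Module.End F (ℕ →₀ F)}
    (hT : ∀ i, i ≠ k → i ≠ k + 1 → i ≠ σ k → i ≠ σ (k + 1) → T (stdE F i) = stdE F i)
    (hc : ∀ i, i ≠ k → i ≠ k + 1 → i ≠ σ k → i ≠ σ (k + 1) → c' i = c i)
    (hσ : ∀ i < s, i ≠ k → i ≠ k + 1 → i ≠ σ k → i ≠ σ (k + 1) → σ' i = σ i)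
    (h1 : stdDiff s σ' c' (T (stdE F k)) = T (stdDiff s σ c (stdE F k)))
    (h2 : stdDiff s σ' c' (T (stdE F (k + 1))) = T (stdDiff s σ c (stdE F (k + 1))))
    (h3 : stdDiff s σ' c' (T (stdE F (σ k))) = T (stdDiff s σ c (stdE F (σ k))))
    (h4 : stdDiff s σ' c' (T (stdE F (σ (k + 1)))) = T (stdDiff s σ c (stdE F (σ (k + 1))))) :
    stdDiff s σ' c' * T = T * stdDiff s σ c := by
  have hk := h.hk
  refine end_ext_stdE fun i => ?_
  change stdDiff s σ' c' (T (stdE F i)) = T (stdDiff s σ c (stdE F i))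
  by_cases e1 : i = k
  · rw [e1, h1]
  by_cases e2 : i = k + 1
  · rw [e2, h2]
  by_cases e3 : i = σ k
  · rw [e3, h3]
  by_cases e4 : i = σ (k + 1)
  · rw [e4, h4]
  rw [hT i e1 e2 e3 e4]
  rcases lt_or_ge i s with hi | hi
  · rw [stdDiff_stdE, stdDiff_stdE, hσ i hi e1 e2 e3 e4, hc i e1 e2 e3 e4]
    have hinj : ∀ j < s, i ≠ σ j → σ i ≠ j := fun j hj hij h' => hij (by rw [← h', h.inv i hi])
    split_ifs
    · rw [map_smul, hT]
      · exact hinj k (by omega) e3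
      · exact hinj (k + 1) hk e4
      · exact hinj _ (h.lt _ (by omega)) (by rw [h.inv k (by omega)]; exact e1)
      · exact hinj _ (h.lt _ hk) (by rw [h.inv _ hk]; exact e2)
    · rw [map_zero]
  · rw [stdDiff_of_le hi, stdDiff_of_le hi, map_zero]

end CrossingInvolution

/-! ### Returns and departures -/

/-- The chain map past a crossing with a handleslide to its left. -/
theorem swap_slide_top (r : F) :
    (swapMap F k * slideMap ⟨k, k + 1, r⟩) (stdE F k) = stdE F (k + 1) - r • stdE F k := by
  simp [slideMap_stdE, swapMap_stdE]

theorem swap_slide_bot (r : F) :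
    (swapMap F k * slideMap ⟨k, k + 1, r⟩) (stdE F (k + 1)) = stdE F k := by
  simp [slideMap_stdE, swapMap_stdE]

theorem swap_slide_of_ne (r : F) {i : ℕ} (h1 : i ≠ k) (h2 : i ≠ k + 1) :
    (swapMap F k * slideMap ⟨k, k + 1, r⟩) (stdE F i) = stdE F i := by
  simp [slideMap_stdE, swapMap_stdE, h1, Equiv.swap_apply_of_ne_of_ne h1 h2]

theorem stdDiff_swap (h : CrossingInvolution s k σ)
    (hσ : ∀ i < s, σ' i = Equiv.swap k (k + 1) (σ (Equiv.swap k (k + 1) i))) :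
    stdDiff s σ' (fun i => c (Equiv.swap k (k + 1) i)) * swapMap F k =
      swapMap F k * stdDiff s σ c := by
  refine end_ext_stdE fun i => ?_
  simp only [Module.End.mul_apply, swapMap_stdE]
  simp only [stdDiff_stdE, Equiv.swap_apply_self, swap_lt_iff h.hk]
  by_cases hi : i < s
  · rw [hσ _ ((swap_lt_iff h.hk).2 hi), Equiv.swap_apply_self]
    have h1 : ¬ (i = k ∧ σ i = k + 1) := by
      rintro ⟨rfl, h'⟩; exact h.hne h'
    have h2 : ¬ (σ i = k ∧ i = k + 1) := by
      rintro ⟨h', rfl⟩; exact h.ne_right h'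
    have h3 : Equiv.swap k (k + 1) i < Equiv.swap k (k + 1) (σ i) ↔ i < σ i := by
      refine ⟨fun h' => ?_, fun h' => swap_lt_swap h' h1⟩
      by_contra hc
      have := swap_lt_swap (lt_of_le_of_ne (not_lt.1 hc) (h.ne i hi)) h2
      omega
    simp only [h3]
    split_ifs
    · rw [map_smul, swapMap_stdE]
    · rw [map_zero]
  · simp [hi]

theorem CrossingInvolution.facts (h : CrossingInvolution s k σ) :
    σ k ≠ k ∧ σ k ≠ k + 1 ∧ σ (k + 1) ≠ k ∧ σ (k + 1) ≠ k + 1 ∧ σ k < s ∧ σ (k + 1) < s ∧ k < s ∧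
      σ (σ k) = k ∧ σ (σ (k + 1)) = k + 1 := by
  have hk := h.hk
  exact ⟨h.ne k (by omega), h.hne, h.ne_right, h.ne _ hk, h.lt k (by omega), h.lt _ hk, by omega,
    h.inv k (by omega), h.inv _ hk⟩

/-- Standard differentials before and after a return.  The handleslide before the crossing creates
a coefficient between the two disks, unless the return has type (R1); the companion handleslide,
with coefficient `t`, cancels it. -/
theorem stdDiff_return (h : CrossingInvolution s k σ) {r t : F} {T : Module.End F (ℕ →₀ F)}
    (hσ : ∀ i < s, σ' i = Equiv.swap k (k + 1) (σ (Equiv.swap k (k + 1) i)))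
    (hc : ∀ i, c' i = c (Equiv.swap k (k + 1) i))
    (hT : ∀ i, i ≠ k → i ≠ k + 1 → i ≠ σ k → T (stdE F i) = stdE F i)
    (Tk : T (stdE F k) = stdE F (k + 1) - r • stdE F k) (Tk' : T (stdE F (k + 1)) = stdE F k)
    (TA : T (stdE F (σ k)) = stdE F (σ k) - t • stdE F (σ (k + 1)))
    (ht : (σ (k + 1) < k ∧ k + 1 < σ k ∧ t = 0) ∨
      (ConfigR2 σ k ∧ c (σ (k + 1)) * t = c (σ k) * r) ∨
        (ConfigR3 σ k ∧ c k * t = r * c (k + 1))) :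
    stdDiff s σ' c' * T = T * stdDiff s σ c := by
  have hk := h.hk
  obtain ⟨a1, a2, a3, a4, lA, lB, lk, iA, iB⟩ := h.facts
  have a5 := h.companions_ne
  have TB := hT _ a3 a4 a5.symm
  have σk : σ' k = σ (k + 1) := by
    rw [hσ k lk, Equiv.swap_apply_left, Equiv.swap_apply_of_ne_of_ne a3 a4]
  have σk' : σ' (k + 1) = σ k := by
    rw [hσ (k + 1) hk, Equiv.swap_apply_right, Equiv.swap_apply_of_ne_of_ne a1 a2]
  have σA : σ' (σ k) = k + 1 := by
    rw [hσ _ lA, Equiv.swap_apply_of_ne_of_ne a1 a2, iA, Equiv.swap_apply_left]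
  have σB : σ' (σ (k + 1)) = k := by
    rw [hσ _ lB, Equiv.swap_apply_of_ne_of_ne a3 a4, iB, Equiv.swap_apply_right]
  have ck : c' k = c (k + 1) := by rw [hc, Equiv.swap_apply_left]
  have ck' : c' (k + 1) = c k := by rw [hc, Equiv.swap_apply_right]
  have cA : c' (σ k) = c (σ k) := by rw [hc, Equiv.swap_apply_of_ne_of_ne a1 a2]
  have cB : c' (σ (k + 1)) = c (σ (k + 1)) := by rw [hc, Equiv.swap_apply_of_ne_of_ne a3 a4]
  have hgen : ∀ i < s, i ≠ k → i ≠ k + 1 → i ≠ σ k → i ≠ σ (k + 1) → σ' i = σ i := by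
    intro i hi e1 e2 e3 e4
    rw [hσ i hi, Equiv.swap_apply_of_ne_of_ne e1 e2, Equiv.swap_apply_of_ne_of_ne]
    · exact fun h' => e3 (by rw [← h', h.inv i hi])
    · exact fun h' => e4 (by rw [← h', h.inv i hi])
  refine h.stdDiff_mul_eq (fun i e1 e2 e3 _ => hT i e1 e2 e3)
    (fun i e1 e2 _ _ => by rw [hc, Equiv.swap_apply_of_ne_of_ne e1 e2]) hgen ?_ ?_ ?_ ?_
  all_goals rcases ht with ⟨b1, b2, rfl⟩ | ⟨⟨b1, b2⟩, b3⟩ | ⟨⟨b1, b2⟩, b3⟩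
  all_goals simp only [Tk, Tk', TA, TB, map_sub, map_smul, stdDiff_stdE, σk, σk', σA, σB, ck, ck',
    cA, cB, iA, iB]
  all_goals simp only [lk, hk, lA, lB, true_and]
  all_goals repeat first | rw [if_pos (by omega)] | rw [if_neg (by omega)]
  all_goals try simp only [Tk, Tk', TA, TB, map_smul, map_zero, smul_zero, sub_zero]
  all_goals match_scalars <;> first | ring1 | linear_combination b3 | linear_combination -b3

/-! ### Switches -/

/-- The chain map past a switch with its two handleslides on the crossing strands. -/
theorem slide_swap_slide_top {r : F} (hr : r ≠ 0) :
    (slideMap ⟨k, k + 1, -r⁻¹⟩ * (swapMap F k * slideMap ⟨k, k + 1, r⟩)) (stdE F k) =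
      -r • stdE F k := by
  rw [Module.End.mul_apply, swap_slide_top, map_sub, map_smul, slideMap_stdE_top,
    slideMap_stdE_of_ne _ (by omega), smul_sub, smul_smul, mul_neg, mul_inv_cancel₀ hr]
  module

theorem slide_swap_slide_bot (r : F) :
    (slideMap ⟨k, k + 1, -r⁻¹⟩ * (swapMap F k * slideMap ⟨k, k + 1, r⟩)) (stdE F (k + 1)) =
      stdE F k + r⁻¹ • stdE F (k + 1) := by
  rw [Module.End.mul_apply, swap_slide_bot, slideMap_stdE_top]
  module

/-- The coefficients of the standard differential after a switch, where `r'` is the reciprocal of the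
coefficient `r` of the handleslide before it.  Only the values at upper strands of disks matter; `σ k`
and `k + 1` are upper strands in type (S1), `σ k` and `σ (k + 1)` in type (S2), `k` and `k + 1` in
type (S3). -/
noncomputable def switchCoeff {R : Type*} [CommRing R] (σ : ℕ → ℕ) (k : ℕ) (r r' : R) (c : ℕ → R)
    (i : ℕ) : R :=
  if i = σ k then -(r * c i)
  else if i = σ (k + 1) then r' * c i
  else if i = k then -(r' * c i)
  else if i = k + 1 then r * c i
  else c i

/-- Standard differentials before and after a switch.  For nested disks, the companion handleslide,
with coefficient `t`, cancels the coefficient between them. -/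
theorem stdDiff_switch (h : CrossingInvolution s k σ) {r t : F} (hr : r ≠ 0)
    {T : Module.End F (ℕ →₀ F)} (hσ : ∀ i < s, σ i = σ' i)
    (hT : ∀ i, i ≠ k → i ≠ k + 1 → i ≠ σ (k + 1) → T (stdE F i) = stdE F i)
    (Tk : T (stdE F k) = -r • stdE F k)
    (Tk' : T (stdE F (k + 1)) = stdE F k + r⁻¹ • stdE F (k + 1))
    (TB : T (stdE F (σ (k + 1))) = stdE F (σ (k + 1)) - t • stdE F (σ k))
    (ht : (ConfigS1 σ k ∧ t = 0) ∨
      (ConfigS2 σ k ∧ r * c (σ k) * t = c (σ (k + 1))) ∨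
        (ConfigS3 σ k ∧ r * c (k + 1) * t = c k)) :
    stdDiff s σ' (switchCoeff σ k r r⁻¹ c) * T = T * stdDiff s σ c := by
  have hk := h.hk
  obtain ⟨a1, a2, a3, a4, lA, lB, lk, iA, iB⟩ := h.facts
  have a5 := h.companions_ne
  have TA := hT _ a1 a2 a5
  have σk := (hσ k lk).symm
  have σk' := (hσ (k + 1) hk).symm
  have σA := (hσ _ lA).symm.trans iA
  have σB := (hσ _ lB).symm.trans iB
  have ck : switchCoeff σ k r r⁻¹ c k = -(r⁻¹ * c k) := by
    simp [switchCoeff, a1.symm, a3.symm]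
  have ck' : switchCoeff σ k r r⁻¹ c (k + 1) = r * c (k + 1) := by
    simp [switchCoeff, a2.symm, a4.symm]
  have cA : switchCoeff σ k r r⁻¹ c (σ k) = -(r * c (σ k)) := by simp [switchCoeff]
  have cB : switchCoeff σ k r r⁻¹ c (σ (k + 1)) = r⁻¹ * c (σ (k + 1)) := by
    simp [switchCoeff, a5.symm]
  refine h.stdDiff_mul_eq (fun i e1 e2 _ e4 => hT i e1 e2 e4)
    (fun i e1 e2 e3 e4 => by simp [switchCoeff, e1, e2, e3, e4])
    (fun i hi _ _ _ _ => (hσ i hi).symm) ?_ ?_ ?_ ?_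
  all_goals rcases ht with ⟨⟨b1, b2⟩, rfl⟩ | ⟨⟨b1, b2⟩, b3⟩ | ⟨⟨b1, b2⟩, b3⟩
  all_goals simp only [Tk, Tk', TA, TB, map_sub, map_add, map_smul, stdDiff_stdE, σk, σk', σA, σB,
    ck, ck', cA, cB, iA, iB]
  all_goals simp only [lk, hk, lA, lB, true_and]
  all_goals repeat first | rw [if_pos (by omega)] | rw [if_neg (by omega)]
  all_goals try simp only [Tk, Tk', TA, TB, map_smul, map_zero, smul_zero, sub_zero]
  all_goals try rw [← b3]
  all_goals match_scalars <;> field_simp <;> ring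

/-! ### Left cusps -/

/-- Standard differentials before and after a simple left cusp.  The isomorphism at the cusp determines
the differential modulo `e_k` and `e_{k+1}`, and simplicity says that these do not occur. -/
theorem stdDiff_leftCusp {d : Module.End F (ℕ →₀ F)} (hks : k ≤ s)
    (hσk : σ' k = k + 1) (hσk' : σ' (k + 1) = k)
    (hσ : ∀ i < s, σ' (skip k i) = skip k (σ i)) (hck : c' k = 1)
    (hc : ∀ i, c' (skip k i) = c i) (htri : IsTriangularDifferential (s + 2) d)
    (hd : d (stdE F k) = stdE F (k + 1))
    (hsimple : ∀ j < k, entry d j k = 0 ∧ entry d j (k + 1) = 0)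
    (hiso : IsCuspIso k (stdDiff s σ c) d) : d = stdDiff (s + 2) σ' c' := by
  refine end_ext_stdE fun j => ?_
  by_cases h1 : j = k
  · rw [h1, hd, stdDiff_upper (by omega) hσk (by omega), hck, one_smul]
  by_cases h2 : j = k + 1
  · rw [h2, stdDiff_lower hσk' (by omega), ← hd, htri.apply_apply]
  obtain ⟨i, rfl⟩ := exists_skip h1 h2
  have hstd : stdDiff (s + 2) σ' c' (stdE F (skip k i)) =
      skipMap F k (stdDiff s σ c (stdE F i)) := by
    rw [stdDiff_stdE, stdDiff_stdE]
    by_cases hi : i < s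
    · rw [hσ i hi, hc]
      have hi' : skip k i < s + 2 := by unfold skip; split_ifs <;> omega
      simp only [hi, hi', skip_lt_skip, true_and]
      split_ifs
      · rw [map_smul, skipMap_stdE]
      · rw [map_zero]
    · have hi' : ¬ skip k i < s + 2 := by unfold skip; split_ifs <;> omega
      rw [if_neg (by tauto), if_neg (by tauto), map_zero]
  rw [hstd]
  set v := skipMap F k (stdDiff s σ c (stdE F i)) with hv
  have hQ : v - d (stdE F (skip k i)) ∈ Submodule.span F {stdE F k, d (stdE F k)} := by
    have := LinearMap.congr_fun hiso.2 (stdE F i)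
    refine (Submodule.Quotient.eq _).1 (this.trans ?_)
    simp [skipMap_stdE]
  rw [hd, Submodule.mem_span_pair] at hQ
  obtain ⟨a, b, hab⟩ := hQ
  have hv0 : v k = 0 ∧ v (k + 1) = 0 :=
    ⟨skipMap_apply_of_forall_ne _ fun i => (skip_ne k i).1,
      skipMap_apply_of_forall_ne _ fun i => (skip_ne k i).2⟩
  have hd0 : d (stdE F (skip k i)) k = 0 ∧ d (stdE F (skip k i)) (k + 1) = 0 := by
    by_cases h3 : skip k i < k
    · exact hsimple _ h3
    · exact ⟨htri.entry_eq_zero (by omega), htri.entry_eq_zero (by omega)⟩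
  have e1 := DFunLike.congr_fun hab k
  have e2 := DFunLike.congr_fun hab (k + 1)
  simp [stdE_apply, hv0, hd0] at e1 e2
  rw [e1, e2, zero_smul, zero_smul, add_zero] at hab
  exact (sub_eq_zero.1 hab.symm).symm

end Standard

/-! ### Moving handleslides commutes with ring homomorphisms -/

section Naturality

variable {R R' : Type*}

/-- Apply a function to the coefficient of a handleslide. -/
def Handleslide.map (f : R → R') (h : Handleslide R) : Handleslide R' := ⟨h.top, h.bot, f h.coeff⟩

variable [CommRing R] [CommRing R'] (f : R →+* R')

theorem map_insertSlide (h : Handleslide R) (V : List (Handleslide R)) :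
    (insertSlide h V).map (Handleslide.map f) =
      insertSlide (h.map f) (V.map (Handleslide.map f)) := by
  induction V with
  | nil => rfl
  | cons g V ih =>
    rw [List.map_cons, insertSlide, insertSlide]
    by_cases h1 : h.SameEnds g
    · have h1' : (h.map f).SameEnds (g.map f) := h1
      rw [if_pos h1, if_pos h1']
      simp [Handleslide.map]
    · have h1' : ¬ (h.map f).SameEnds (g.map f) := h1
      rw [if_neg h1, if_neg h1']
      by_cases h2 : h.Prec g
      · have h2' : (h.map f).Prec (g.map f) := h2
        rw [if_pos h2, if_pos h2', List.map_cons, List.map_cons]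
      · have h2' : ¬ (h.map f).Prec (g.map f) := h2
        rw [if_neg h2, if_neg h2', List.map_cons, ih]

theorem map_foldr_insertSlide (L V : List (Handleslide R)) :
    (L.foldr insertSlide V).map (Handleslide.map f) =
      (L.map (Handleslide.map f)).foldr insertSlide (V.map (Handleslide.map f)) := by
  induction L with
  | nil => rfl
  | cons h L ih => simp only [List.foldr_cons, List.map_cons, map_insertSlide, ih]

theorem map_interchange (g h : Handleslide R) :
    (interchange g h).map (Handleslide.map f) = interchange (g.map f) (h.map f) := by
  unfold interchange
  by_cases h1 : g.bot = h.top
  · have h1' : (g.map f).bot = (h.map f).top := h1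
    rw [if_pos h1, if_pos h1']
    simp [Handleslide.map]
  · have h1' : ¬ (g.map f).bot = (h.map f).top := h1
    rw [if_neg h1, if_neg h1']
    by_cases h2 : g.top = h.bot
    · have h2' : (g.map f).top = (h.map f).bot := h2
      rw [if_pos h2, if_pos h2']
      simp [Handleslide.map]
    · have h2' : ¬ (g.map f).top = (h.map f).bot := h2
      rw [if_neg h2, if_neg h2', List.map_nil]

theorem map_incorporate (h : Handleslide R) (V : List (Handleslide R)) :
    (incorporate h V).map (Handleslide.map f) =
      incorporate (h.map f) (V.map (Handleslide.map f)) := by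
  induction V with
  | nil => rfl
  | cons g V ih =>
    rw [List.map_cons, incorporate, incorporate]
    by_cases h1 : h.SameEnds g
    · have h1' : (h.map f).SameEnds (g.map f) := h1
      rw [if_pos h1, if_pos h1']
      simp [Handleslide.map]
    · have h1' : ¬ (h.map f).SameEnds (g.map f) := h1
      rw [if_neg h1, if_neg h1']
      by_cases h2 : h.Prec g
      · have h2' : (h.map f).Prec (g.map f) := h2
        rw [if_pos h2, if_pos h2', List.map_cons, List.map_cons]
      · have h2' : ¬ (h.map f).Prec (g.map f) := h2
        rw [if_neg h2, if_neg h2', List.map_cons, map_foldr_insertSlide, map_interchange, ih]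

theorem map_foldl_incorporate (L V : List (Handleslide R)) :
    (L.foldl (fun V h => incorporate h V) V).map (Handleslide.map f) =
      (L.map (Handleslide.map f)).foldl (fun V h => incorporate h V)
        (V.map (Handleslide.map f)) := by
  induction L generalizing V with
  | nil => rfl
  | cons h L ih => simp only [List.foldl_cons, List.map_cons, ih, map_incorporate]

theorem map_passLeft (h : Handleslide R) (V : List (Handleslide R)) :
    (passLeft h V).map (Handleslide.map f) = passLeft (h.map f) (V.map (Handleslide.map f)) := by
  induction V with
  | nil => rfl
  | cons g V ih =>
    simp only [passLeft, List.map_cons, map_foldr_insertSlide, map_interchange, ih]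

theorem map_removeSlide (a b : ℕ) (V : List (Handleslide R)) :
    (removeSlide a b V).map (Handleslide.map f) =
      removeSlide a b (V.map (Handleslide.map f)) := by
  induction V with
  | nil => rfl
  | cons g V ih =>
    rw [List.map_cons, removeSlide, removeSlide]
    by_cases h1 : g.top = a ∧ g.bot = b
    · have h1' : (g.map f).top = a ∧ (g.map f).bot = b := h1
      rw [if_pos h1, if_pos h1', map_passLeft]
    · have h1' : ¬ ((g.map f).top = a ∧ (g.map f).bot = b) := h1
      rw [if_neg h1, if_neg h1', List.map_cons, ih]

theorem map_slideCoeff (a b : ℕ) (V : List (Handleslide R)) :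
    f (slideCoeff a b V) = slideCoeff a b (V.map (Handleslide.map f)) := by
  induction V with
  | nil => simp [slideCoeff]
  | cons g V ih =>
    rw [List.map_cons, slideCoeff, slideCoeff]
    by_cases h1 : g.top = a ∧ g.bot = b
    · have h1' : (g.map f).top = a ∧ (g.map f).bot = b := h1
      rw [if_pos h1, if_pos h1', Handleslide.map]
    · have h1' : ¬ ((g.map f).top = a ∧ (g.map f).bot = b) := h1
      rw [if_neg h1, if_neg h1', ih]

theorem map_passCrossing (k : ℕ) (V : List (Handleslide R)) :
    (passCrossing k V).map (Handleslide.map f) = passCrossing k (V.map (Handleslide.map f)) := by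
  simp only [passCrossing, map_foldr_insertSlide, List.map_map, List.map_nil]
  rfl

theorem map_passRightCusp (k : ℕ) (V : List (Handleslide R)) :
    (passRightCusp k V).map (Handleslide.map f) = passRightCusp k (V.map (Handleslide.map f)) := by
  simp only [passRightCusp, List.map_map, List.filter_map]
  rfl

end Naturality

/-! ### Laurent polynomials -/

namespace LaurentPoly

variable {F S T : Type*} [Field F]

/-- Evaluation of Laurent polynomials as a homomorphism of algebras. -/
noncomputable def evalHom (x : S → F) (hx : ∀ s, x s ≠ 0) (z : T → F) :
    LaurentPoly F S T →ₐ[F] F :=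
  AddMonoidAlgebra.lift F F ((S →₀ ℤ) × (T →₀ ℕ))
    { toFun := fun e => (e.toAdd.1.prod fun s n => x s ^ n) * (e.toAdd.2.prod fun t n => z t ^ n)
      map_one' := by simp
      map_mul' := fun e e' => by
        simp only [toAdd_mul, Prod.fst_add, Prod.snd_add]
        rw [Finsupp.prod_add_index' (by simp) (fun s a b => zpow_add₀ (hx s) a b),
          Finsupp.prod_add_index' (by simp) (fun t a b => pow_add (z t) a b)]
        ring }

theorem evalHom_apply (x : S → F) (hx : ∀ s, x s ≠ 0) (z : T → F) (g : LaurentPoly F S T) :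
    evalHom x hx z g = g.eval x z := by
  rw [evalHom, AddMonoidAlgebra.lift_apply, eval]
  refine Finsupp.sum_congr fun e _ => ?_
  simp [mul_assoc]

/-- The power `x_s ^ n` of an invertible variable. -/
noncomputable def unitVar (F T : Type*) {S : Type*} [Field F] (s : S) (n : ℤ) : LaurentPoly F S T :=
  AddMonoidAlgebra.single (Finsupp.single s n, 0) 1

/-- The variable `z_t`. -/
noncomputable def freeVar (F S : Type*) {T : Type*} [Field F] (t : T) : LaurentPoly F S T :=
  AddMonoidAlgebra.single (0, Finsupp.single t 1) 1

theorem evalHom_unitVar (x : S → F) (hx : ∀ s, x s ≠ 0) (z : T → F) (s : S) (n : ℤ) :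
    evalHom x hx z (unitVar F T s n) = x s ^ n := by
  rw [evalHom, unitVar, AddMonoidAlgebra.lift_single]
  simp

theorem evalHom_freeVar (x : S → F) (hx : ∀ s, x s ≠ 0) (z : T → F) (t : T) :
    evalHom x hx z (freeVar F S t) = z t := by
  rw [evalHom, freeVar, AddMonoidAlgebra.lift_single]
  simp

theorem isUnit_unitVar (s : S) (n : ℤ) : IsUnit (unitVar F T s n) := by
  refine IsUnit.of_mul_eq_one (unitVar F T s (-n)) ?_
  rw [unitVar, unitVar, AddMonoidAlgebra.single_mul_single, AddMonoidAlgebra.one_def]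
  simp only [Prod.mk_add_mk, ← Finsupp.single_add, add_neg_cancel, Finsupp.single_zero, add_zero,
    mul_one]
  rfl

end LaurentPoly

/-! ### The differentials of an SR-form sequence -/

section Companions

variable {R : Type*} [CommRing R]

/-- The companion handleslide of a switch with reciprocal coefficient `r'`; here `c i` is the
coefficient for the disk with upper strand `i`, and `ci i` its reciprocal. -/
noncomputable def switchCompanion (σ : ℕ → ℕ) (k : ℕ) (c ci : ℕ → R) (r' : R) :
    List (Handleslide R) :=
  open Classical in
  if ConfigS2 σ k then [⟨σ (k + 1), σ k, c (σ (k + 1)) * r' * ci (σ k)⟩]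
  else if ConfigS3 σ k then [⟨σ (k + 1), σ k, c k * r' * ci (k + 1)⟩]
  else []

/-- The companion handleslide of a return with coefficient `r`; here `c i` is the coefficient for the
disk with upper strand `i`, and `ci i` its reciprocal. -/
noncomputable def returnCompanion (σ : ℕ → ℕ) (k : ℕ) (c ci : ℕ → R) (r : R) :
    List (Handleslide R) :=
  open Classical in
  if ConfigR2 σ k then [⟨σ k, σ (k + 1), c (σ k) * r * ci (σ (k + 1))⟩]
  else if ConfigR3 σ k then [⟨σ k, σ (k + 1), ci k * r * c (k + 1)⟩]
  else []

variable {R' : Type*} [CommRing R'] (f : R →+* R')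

theorem map_switchCompanion (σ : ℕ → ℕ) (k : ℕ) (c ci : ℕ → R) (r' : R) :
    (switchCompanion σ k c ci r').map (Handleslide.map f) =
      switchCompanion σ k (fun i => f (c i)) (fun i => f (ci i)) (f r') := by
  unfold switchCompanion
  split_ifs <;> simp [Handleslide.map]

theorem map_returnCompanion (σ : ℕ → ℕ) (k : ℕ) (c ci : ℕ → R) (r : R) :
    (returnCompanion σ k c ci r).map (Handleslide.map f) =
      returnCompanion σ k (fun i => f (c i)) (fun i => f (ci i)) (f r) := by
  unfold returnCompanion
  split_ifs <;> simp [Handleslide.map]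

theorem map_switchCoeff (σ : ℕ → ℕ) (k : ℕ) (r r' : R) (c : ℕ → R) (i : ℕ) :
    f (switchCoeff σ k r r' c i) = switchCoeff σ k (f r) (f r') (fun i => f (c i)) i := by
  unfold switchCoeff
  split_ifs <;> simp

theorem isUnit_switchCoeff (σ : ℕ → ℕ) (k : ℕ) {r r' : R} {c : ℕ → R} (hr : IsUnit r)
    (hr' : IsUnit r') (hc : ∀ i, IsUnit (c i)) (i : ℕ) : IsUnit (switchCoeff σ k r r' c i) := by
  unfold switchCoeff
  split_ifs
  · exact (hr.mul (hc i)).neg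
  · exact hr'.mul (hc i)
  · exact (hr'.mul (hc i)).neg
  · exact hr.mul (hc i)
  · exact hc i

theorem slidesConj_mul_slideProd {L : List (Handleslide R)} (hL : AllEnds (· < ·) L)
    (d : Module.End R (ℕ →₀ R)) :
    slidesConj L d * slideProd L.reverse = slideProd L.reverse * d := by
  induction L generalizing d with
  | nil => simp [slidesConj, slideProd]
  | cons g L ih =>
    rw [allEnds_cons] at hL
    have h1 : slideProd (g :: L).reverse = slideProd L.reverse * slideMap g := by
      simp [slideProd]
    rw [h1, ← mul_assoc]
    change slidesConj L (slideConj g d) * slideProd L.reverse * slideMap g = _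
    rw [ih hL.2, mul_assoc, slideConj_mul hL.1.ne, mul_assoc]

end Companions

theorem MCS.d_eq_slidesConj {R : Type*} [CommRing R] {D : FrontDiagram} {pts : D.MarkedPoints}
    (C : MCS R D pts) {l : ℕ} (hl : l ≤ D.events.length) (L L' : List (Handleslide R))
    (hL : C.slides l = L ++ L') : C.d l L.length = slidesConj L (C.d l 0) := by
  induction L using List.reverseRecOn generalizing L' with
  | nil => rfl
  | append_singleton L h ih =>
    have hiso := C.slide_iso l hl L.length h (by rw [hL]; simp)
    have hh := C.slides_valid l hl h (by rw [hL]; simp)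
    rw [List.length_append, List.length_singleton, hiso.eq_slideConj hh.1.ne,
      ih (h :: L') (by rw [hL]; simp)]
    simp [slidesConj]

namespace NormalRuling

variable {D : FrontDiagram} (ρ : NormalRuling D)

theorem crossingInvolution {l k : ℕ} (h : D.events[l]? = some (.crossing k)) :
    CrossingInvolution (D.strands l) k (ρ.inv l) :=
  ⟨ρ.inv_lt l, ρ.inv_inv l, ρ.inv_ne l, crossing_lt h, (ρ.crossing l k h).1⟩

theorem isSwitch_iff {l k : ℕ} (h : D.events[l]? = some (.crossing k)) :
    ρ.IsSwitch l ↔ (∀ i < D.strands l, ρ.inv l i = ρ.inv (l + 1) i) ∧ Normality (ρ.inv l) k := by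
  refine ⟨?_, fun h' => ⟨k, h, h'⟩⟩
  rintro ⟨k', hk', h'⟩
  rw [h] at hk'
  cases hk'
  exact h'

theorem inv_succ_of_not_isSwitch {l k : ℕ} (h : D.events[l]? = some (.crossing k))
    (hs : ¬ ρ.IsSwitch l) : ∀ i < D.strands l,
      ρ.inv (l + 1) i = Equiv.swap k (k + 1) (ρ.inv l (Equiv.swap k (k + 1) i)) :=
  (ρ.crossing l k h).2.resolve_right fun h' => hs ((ρ.isSwitch_iff h).2 h')

/-- The types (R1), (R2) and (R3) of returns, in terms of the involution before the crossing. -/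
theorem return_cases {l k : ℕ} (h : D.events[l]? = some (.crossing k)) (hr : ρ.IsReturn l) :
    (ρ.inv l (k + 1) < k ∧ k + 1 < ρ.inv l k) ∨ ConfigR2 (ρ.inv l) k ∨ ConfigR3 (ρ.inv l) k := by
  obtain ⟨k', hk', hs, hn⟩ := hr
  rw [h] at hk'
  cases hk'
  have hk := crossing_lt h
  obtain ⟨a1, a2, a3, a4, -⟩ := (ρ.crossingInvolution h).facts
  have hinv := ρ.inv_succ_of_not_isSwitch h hs
  have e1 : ρ.inv (l + 1) k = ρ.inv l (k + 1) := by
    rw [hinv k (by omega), Equiv.swap_apply_left, Equiv.swap_apply_of_ne_of_ne a3 a4]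
  have e2 : ρ.inv (l + 1) (k + 1) = ρ.inv l k := by
    rw [hinv _ hk, Equiv.swap_apply_right, Equiv.swap_apply_of_ne_of_ne a1 a2]
  unfold Normality ConfigS1 ConfigS2 ConfigS3 at hn
  rw [e1, e2] at hn
  unfold ConfigR2 ConfigR3
  omega

end NormalRuling

namespace MCS.IsSRForm

variable {F : Type*} [Field F] {D : FrontDiagram} {pts : D.MarkedPoints} {C : MCS F D pts}
  {ρ : NormalRuling D} {M : ℕ} {μ : D.MaslovPotential M} {m : ℕ}

theorem preSlides_eq_of_graded {l k : ℕ} (h : D.events[l]? = some (.crossing k))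
    (hsr : ρ.IsSwitch l ∨ ρ.IsGradedReturn μ m l) :
    C.preSlides ρ μ m l = [⟨k, k + 1, C.leftCoeff l⟩] ∧
      C.preCoeff ρ μ m k l = C.leftCoeff l := by
  have h1 : C.preSlides ρ μ m l = [⟨k, k + 1, C.leftCoeff l⟩] := by simp [preSlides, h, hsr]
  exact ⟨h1, by simp [preCoeff, h1, slideCoeff]⟩

theorem d_length_sub_one (hC : C.IsSRForm ρ μ m) {l k : ℕ}
    (h : D.events[l]? = some (.crossing k)) (hsr : ρ.IsSwitch l ∨ ρ.IsGradedReturn μ m l) :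
    C.d l ((C.slides l).length - 1) = C.midDiff ρ μ m l := by
  rw [hC.slides_eq (lt_length_of_event h).le, (preSlides_eq_of_graded h hsr).1, midDiff]
  simp

/-- The differentials before and after a crossing and its handleslides are conjugate. -/
theorem midDiff_succ_mul (hC : C.IsSRForm ρ μ m) {l k : ℕ}
    (h : D.events[l]? = some (.crossing k)) :
    C.midDiff ρ μ m (l + 1) * (slideProd (C.postSlides ρ μ m l).reverse *
        (swapMap F k * slideMap ⟨k, k + 1, C.preCoeff ρ μ m k l⟩)) =
      slideProd (C.postSlides ρ μ m l).reverse *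
        (swapMap F k * slideMap ⟨k, k + 1, C.preCoeff ρ μ m k l⟩) * C.midDiff ρ μ m l := by
  have hlen := lt_length_of_event h
  obtain ⟨-, -, hev⟩ := C.event_condition l _ h
  have hsw : swapMap F k * C.d l (C.slides l).length = C.d (l + 1) 0 * swapMap F k := hev.2
  have hsl := hC.slides_succ l hlen
  have hpost : AllEnds (· < ·) (C.postSlides ρ μ m l) := fun g hg =>
    (C.slides_valid (l + 1) hlen g (by rw [hsl]; exact List.mem_append_left _ hg)).1
  have h1 : C.midDiff ρ μ m (l + 1) = slidesConj (C.postSlides ρ μ m l) (C.d (l + 1) 0) :=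
    C.d_eq_slidesConj hlen _ _ hsl
  rw [h1, ← mul_assoc, slidesConj_mul_slideProd hpost, mul_assoc, mul_assoc,
    ← mul_assoc (C.d (l + 1) 0), ← hsw, hC.d_length_eq (Or.inl h), mul_assoc (swapMap F k),
    slideConj_mul (by simp)]
  simp only [mul_assoc]

/-- The differential after a crossing is determined by the conjugation, as the handleslides and the
interchange of the strands are isomorphisms. -/
theorem midDiff_succ_eq (hC : C.IsSRForm ρ μ m) {l k : ℕ}
    (h : D.events[l]? = some (.crossing k)) {d' : Module.End F (ℕ →₀ F)}
    (hd' : d' * (slideProd (C.postSlides ρ μ m l).reverse *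
        (swapMap F k * slideMap ⟨k, k + 1, C.preCoeff ρ μ m k l⟩)) =
      slideProd (C.postSlides ρ μ m l).reverse *
        (swapMap F k * slideMap ⟨k, k + 1, C.preCoeff ρ μ m k l⟩) * C.midDiff ρ μ m l) :
    C.midDiff ρ μ m (l + 1) = d' := by
  have hlen := lt_length_of_event h
  have hpost : AllEnds (· < ·) (C.postSlides ρ μ m l).reverse := fun g hg =>
    (C.slides_valid (l + 1) hlen g (by
      rw [hC.slides_succ l hlen]
      exact List.mem_append_left _ (List.mem_reverse.1 hg))).1
  have hswap : IsUnit (swapMap F k) := ⟨⟨_, _, swapMap_mul_self k, swapMap_mul_self k⟩, rfl⟩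
  have hT : IsUnit (slideProd (C.postSlides ρ μ m l).reverse *
      (swapMap F k * slideMap ⟨k, k + 1, C.preCoeff ρ μ m k l⟩)) :=
    (slideProd_isUnit hpost).mul (hswap.mul (slideMap_isUnit (by simp)))
  exact hT.mul_right_cancel ((hC.midDiff_succ_mul h).trans hd'.symm)

theorem postSlides_switch (hC : C.IsSRForm ρ μ m) {l k : ℕ}
    (h : D.events[l]? = some (.crossing k)) (hs : ρ.IsSwitch l) {c : ℕ → F}
    (hd : C.midDiff ρ μ m l = stdDiff (D.strands l) (ρ.inv l) c) :
    C.postSlides ρ μ m l = ⟨k, k + 1, -(C.leftCoeff l)⁻¹⟩ ::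
      switchCompanion (ρ.inv l) k c (fun i => (c i)⁻¹) (C.leftCoeff l)⁻¹ := by
  have hinv := ρ.crossingInvolution h
  obtain ⟨a1, a2, a3, a4, lA, lB, lk, iA, iB⟩ := hinv.facts
  simp only [postSlides, h, hs, if_true, hC.d_length_sub_one h (Or.inl hs), hd, switchCompanion]
  congr 1
  split_ifs with h2 h3
  · unfold ConfigS2 at h2
    rw [entry_stdDiff lB iB (by omega), entry_stdDiff lA iA (by omega)]
  · unfold ConfigS3 at h3
    rw [entry_stdDiff lk rfl (by omega), entry_stdDiff hinv.hk rfl (by omega)]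
  · rfl

theorem postSlides_return (hC : C.IsSRForm ρ μ m) {l k : ℕ}
    (h : D.events[l]? = some (.crossing k)) (hs : ρ.IsGradedReturn μ m l) {c : ℕ → F}
    (hd : C.midDiff ρ μ m l = stdDiff (D.strands l) (ρ.inv l) c) :
    C.postSlides ρ μ m l =
      returnCompanion (ρ.inv l) k c (fun i => (c i)⁻¹) (C.leftCoeff l) := by
  have hinv := ρ.crossingInvolution h
  obtain ⟨a1, a2, a3, a4, lA, lB, lk, iA, iB⟩ := hinv.facts
  have hns : ¬ ρ.IsSwitch l := by
    obtain ⟨_, _, hns, _⟩ := hs.1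
    exact hns
  simp only [postSlides, h, hs, hns, if_true, if_false, hC.d_length_sub_one h (Or.inr hs), hd,
    returnCompanion]
  split_ifs with h2 h3
  · unfold ConfigR2 at h2
    rw [entry_stdDiff lA iA (by omega), entry_stdDiff lB iB (by omega)]
  · unfold ConfigR3 at h3
    rw [entry_stdDiff lk rfl (by omega), entry_stdDiff hinv.hk rfl (by omega)]
  · rfl

theorem midDiff_switch (hC : C.IsSRForm ρ μ m) {l k : ℕ}
    (h : D.events[l]? = some (.crossing k)) (hs : ρ.IsSwitch l) {c : ℕ → F} (hc : ∀ i, c i ≠ 0)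
    (hd : C.midDiff ρ μ m l = stdDiff (D.strands l) (ρ.inv l) c) :
    C.midDiff ρ μ m (l + 1) = stdDiff (D.strands (l + 1)) (ρ.inv (l + 1))
      (switchCoeff (ρ.inv l) k (C.leftCoeff l) (C.leftCoeff l)⁻¹ c) := by
  have hr := hC.coeff_ne_zero l hs
  have hinv := ρ.crossingInvolution h
  obtain ⟨a1, a2, a3, a4, -⟩ := hinv.facts
  have a5 := hinv.companions_ne
  obtain ⟨hσ, hn⟩ := (ρ.isSwitch_iff h).1 hs
  set σ := ρ.inv l
  set r := C.leftCoeff l with hrdef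
  refine hC.midDiff_succ_eq h ?_
  rw [hd, (preSlides_eq_of_graded h (Or.inl hs)).2, ← hrdef, hC.postSlides_switch h hs hd, ← hrdef,
    strands_succ h]
  -- The companion handleslide has coefficient `t`, which is zero if there is none.
  obtain ⟨t, ht, hχ⟩ : ∃ t, ((ConfigS1 σ k ∧ t = 0) ∨ (ConfigS2 σ k ∧ r * c (σ k) * t = c (σ (k + 1))) ∨
        (ConfigS3 σ k ∧ r * c (k + 1) * t = c k)) ∧
      slideProd (switchCompanion σ k c (fun i => (c i)⁻¹) r⁻¹).reverse =
        slideMap ⟨σ (k + 1), σ k, t⟩ := by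
    unfold switchCompanion
    rcases hn with hn | hn | hn
    · refine ⟨0, Or.inl ⟨hn, rfl⟩, ?_⟩
      unfold ConfigS1 at hn
      rw [if_neg (by unfold ConfigS2; omega), if_neg (by unfold ConfigS3; omega), slideMap_zero]
      rfl
    · refine ⟨c (σ (k + 1)) * r⁻¹ * (c (σ k))⁻¹, Or.inr (Or.inl ⟨hn, ?_⟩), ?_⟩
      · have := hc (σ k)
        field_simp
      · rw [if_pos hn]
        simp [slideProd]
    · refine ⟨c k * r⁻¹ * (c (k + 1))⁻¹, Or.inr (Or.inr ⟨hn, ?_⟩), ?_⟩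
      · have := hc (k + 1)
        field_simp
      · have h2 : ¬ ConfigS2 σ k := by unfold ConfigS2 ConfigS3 at *; omega
        rw [if_neg h2, if_pos hn]
        simp [slideProd]
  have hT : slideProd ((⟨k, k + 1, -r⁻¹⟩ : Handleslide F) ::
      switchCompanion σ k c (fun i => (c i)⁻¹) r⁻¹).reverse *
        (swapMap F k * slideMap ⟨k, k + 1, r⟩) = slideMap ⟨σ (k + 1), σ k, t⟩ *
          (slideMap ⟨k, k + 1, -r⁻¹⟩ * (swapMap F k * slideMap ⟨k, k + 1, r⟩)) := by
    rw [← hχ]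
    simp [slideProd, mul_assoc]
  rw [hT]
  have hfix : ∀ i, i ≠ k → i ≠ k + 1 →
      (slideMap ⟨k, k + 1, -r⁻¹⟩ * (swapMap F k * slideMap ⟨k, k + 1, r⟩)) (stdE F i) =
        stdE F i := fun i e1 e2 => by
    rw [Module.End.mul_apply, swap_slide_of_ne r e1 e2, slideMap_stdE_of_ne _ e1]
  refine stdDiff_switch hinv hr hσ ?_ ?_ ?_ ?_ ht
  · intro i e1 e2 e3
    rw [Module.End.mul_apply, hfix i e1 e2, slideMap_stdE_of_ne _ e3]
  · rw [Module.End.mul_apply, slide_swap_slide_top hr, map_smul, slideMap_stdE_of_ne _ a3.symm]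
  · rw [Module.End.mul_apply, slide_swap_slide_bot, map_add, map_smul,
      slideMap_stdE_of_ne _ a3.symm, slideMap_stdE_of_ne _ a4.symm]
  · rw [Module.End.mul_apply, hfix _ a3 a4, slideMap_stdE_top]

theorem midDiff_return (hC : C.IsSRForm ρ μ m) {l k : ℕ}
    (h : D.events[l]? = some (.crossing k)) (hs : ρ.IsGradedReturn μ m l) {c : ℕ → F}
    (hc : ∀ i, c i ≠ 0)
    (hd : C.midDiff ρ μ m l = stdDiff (D.strands l) (ρ.inv l) c) :
    C.midDiff ρ μ m (l + 1) = stdDiff (D.strands (l + 1)) (ρ.inv (l + 1))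
      (fun i => c (Equiv.swap k (k + 1) i)) := by
  have hinv := ρ.crossingInvolution h
  obtain ⟨a1, a2, a3, a4, -⟩ := hinv.facts
  have hns : ¬ ρ.IsSwitch l := by
    obtain ⟨_, _, hns, _⟩ := hs.1
    exact hns
  have hσ := ρ.inv_succ_of_not_isSwitch h hns
  have hn := ρ.return_cases h hs.1
  set σ := ρ.inv l
  set r := C.leftCoeff l with hrdef
  refine hC.midDiff_succ_eq h ?_
  rw [hd, (preSlides_eq_of_graded h (Or.inr hs)).2, ← hrdef, hC.postSlides_return h hs hd, ← hrdef,
    strands_succ h]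
  -- The companion handleslide has coefficient `t`, which is zero if there is none.
  obtain ⟨t, ht, hχ⟩ : ∃ t, ((σ (k + 1) < k ∧ k + 1 < σ k ∧ t = 0) ∨
        (ConfigR2 σ k ∧ c (σ (k + 1)) * t = c (σ k) * r) ∨
        (ConfigR3 σ k ∧ c k * t = r * c (k + 1))) ∧
      slideProd (returnCompanion σ k c (fun i => (c i)⁻¹) r).reverse =
        slideMap ⟨σ k, σ (k + 1), t⟩ := by
    unfold returnCompanion
    rcases hn with hn | hn | hn
    · refine ⟨0, Or.inl ⟨hn.1, hn.2, rfl⟩, ?_⟩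
      rw [if_neg (by unfold ConfigR2; omega), if_neg (by unfold ConfigR3; omega), slideMap_zero]
      rfl
    · refine ⟨c (σ k) * r * (c (σ (k + 1)))⁻¹, Or.inr (Or.inl ⟨hn, ?_⟩), ?_⟩
      · have := hc (σ (k + 1))
        field_simp
      · rw [if_pos hn]
        simp [slideProd]
    · refine ⟨(c k)⁻¹ * r * c (k + 1), Or.inr (Or.inr ⟨hn, ?_⟩), ?_⟩
      · have := hc k
        field_simp
      · have h2 : ¬ ConfigR2 σ k := by unfold ConfigR2 ConfigR3 at *; omega
        rw [if_neg h2, if_pos hn]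
        simp [slideProd]
  rw [hχ]
  refine stdDiff_return hinv hσ (fun _ => rfl) ?_ ?_ ?_ ?_ ht
  · intro i e1 e2 e3
    rw [Module.End.mul_apply, swap_slide_of_ne r e1 e2, slideMap_stdE_of_ne _ e3]
  · rw [Module.End.mul_apply, swap_slide_top, map_sub, map_smul, slideMap_stdE_of_ne _ a1.symm,
      slideMap_stdE_of_ne _ a2.symm]
  · rw [Module.End.mul_apply, swap_slide_bot, slideMap_stdE_of_ne _ a1.symm]
  · rw [Module.End.mul_apply, swap_slide_of_ne r a1 a2, slideMap_stdE_top]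

theorem postSlides_eq_nil {l k : ℕ} (h : D.events[l]? = some (.crossing k))
    (hs : ¬ ρ.IsSwitch l) (hr : ¬ ρ.IsGradedReturn μ m l) : C.postSlides ρ μ m l = [] := by
  simp [postSlides, h, hs, hr]

theorem midDiff_departure (hC : C.IsSRForm ρ μ m) {l k : ℕ}
    (h : D.events[l]? = some (.crossing k)) (hs : ¬ ρ.IsSwitch l)
    (hr : ¬ ρ.IsGradedReturn μ m l) {c : ℕ → F}
    (hd : C.midDiff ρ μ m l = stdDiff (D.strands l) (ρ.inv l) c) :
    C.midDiff ρ μ m (l + 1) = stdDiff (D.strands (l + 1)) (ρ.inv (l + 1))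
      (fun i => c (Equiv.swap k (k + 1) i)) := by
  refine hC.midDiff_succ_eq h ?_
  have hpre : C.preCoeff ρ μ m k l = 0 := by simp [preCoeff, preSlides, h, hs, hr, slideCoeff]
  rw [hd, hpre, slideMap_zero, postSlides_eq_nil h hs hr, strands_succ h, List.reverse_nil,
    slideProd_nil, one_mul, mul_one]
  exact stdDiff_swap (ρ.crossingInvolution h) (ρ.inv_succ_of_not_isSwitch h hs)

theorem midDiff_leftCusp (hC : C.IsSRForm ρ μ m) {l k : ℕ}
    (h : D.events[l]? = some (.leftCusp k)) {c : ℕ → F}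
    (hd : C.midDiff ρ μ m l = stdDiff (D.strands l) (ρ.inv l) c) :
    C.midDiff ρ μ m (l + 1) = stdDiff (D.strands (l + 1)) (ρ.inv (l + 1))
      (fun i => if i < k then c i else if i = k then 1 else c (i - 2)) := by
  have hlen := lt_length_of_event h
  obtain ⟨-, hiso⟩ := C.event_condition l _ h
  obtain ⟨hs1, hs2⟩ := hC.simple l k h
  obtain ⟨hσ1, hσ2⟩ := ρ.leftCusp l k h
  have hks : k ≤ D.strands l := D.fits l _ h
  have hs : D.strands (l + 1) = D.strands l + 2 := strands_succ h
  have h1 : C.midDiff ρ μ m (l + 1) = C.d (l + 1) 0 := by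
    rw [midDiff, startSlides, postSlides_leftCusp h]
    rfl
  have hσ' : ρ.inv (l + 1) (k + 1) = k := by
    rw [← hσ1]
    exact ρ.inv_inv (l + 1) k (by omega)
  rw [hC.d_length_leftCusp h, hd] at hiso
  rw [h1, hs]
  refine stdDiff_leftCusp hks hσ1 hσ' hσ2 (by simp) ?_ ?_ hs1 hs2 hiso
  · intro i
    by_cases hi : i < k
    · simp [skip, hi]
    · simp only [skip, hi, if_false]
      rw [if_neg (by omega), if_neg (by omega), Nat.add_sub_cancel]
  · rw [← hs]
    exact C.differential (l + 1) hlen 0 (Nat.zero_le _)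

/-! ### Laurent polynomials in the coefficients at switches and returns -/

/-- Evaluation of Laurent polynomials at the coefficients of the handleslides of an SR-form sequence
immediately to the left of switches, returns and right cusps. -/
noncomputable def eval (hC : C.IsSRForm ρ μ m) :
    LaurentPoly F ρ.Switches (ρ.FreeEvents μ m) →+* F :=
  RingHomClass.toRingHom (LaurentPoly.evalHom (fun s : ρ.Switches => C.leftCoeff s.1)
    (fun s => hC.coeff_ne_zero s.1 s.2) fun t : ρ.FreeEvents μ m => C.leftCoeff t.1)

theorem eval_apply (hC : C.IsSRForm ρ μ m) (g : LaurentPoly F ρ.Switches (ρ.FreeEvents μ m)) :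
    hC.eval g = g.eval (fun s => C.leftCoeff s.1) (fun t => C.leftCoeff t.1) := by
  rw [eval, RingHom.coe_coe, LaurentPoly.evalHom_apply]

theorem eval_unitVar (hC : C.IsSRForm ρ μ m) {l : ℕ} (hs : ρ.IsSwitch l) (n : ℤ) :
    hC.eval (LaurentPoly.unitVar F _ ⟨l, hs⟩ n) = C.leftCoeff l ^ n := by
  rw [eval, RingHom.coe_coe, LaurentPoly.evalHom_unitVar]

theorem eval_freeVar (hC : C.IsSRForm ρ μ m) {l : ℕ} (hl : ρ.IsFree μ m l) :
    hC.eval (LaurentPoly.freeVar F _ ⟨l, hl⟩) = C.leftCoeff l := by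
  rw [eval, RingHom.coe_coe, LaurentPoly.evalHom_freeVar]

theorem eval_ne_zero (hC : C.IsSRForm ρ μ m) {g : LaurentPoly F ρ.Switches (ρ.FreeEvents μ m)}
    (hg : IsUnit g) : hC.eval g ≠ 0 :=
  (hg.map hC.eval).ne_zero

end MCS.IsSRForm

section Laurent

variable {F : Type*} [Field F] {D : FrontDiagram} (pts : D.MarkedPoints)
  (ρ : NormalRuling D) {M : ℕ} (μ : D.MaslovPotential M) (m : ℕ)

/-- The differentials between the handleslides that belong to consecutive events are standard, and
their coefficients are given by units `c i`, independent of the sequence, in the ring of Laurent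
polynomials. -/
def HasLaurentStdDiff (F : Type*) [Field F] (l : ℕ)
    (c : ℕ → LaurentPoly F ρ.Switches (ρ.FreeEvents μ m)) : Prop :=
  (∀ i, IsUnit (c i)) ∧ ∀ (C : MCS F D pts) (hC : C.IsSRForm ρ μ m),
    C.midDiff ρ μ m l = stdDiff (D.strands l) (ρ.inv l) fun i => hC.eval (c i)

/-- The handleslides `V C`, for all SR-form sequences `C`, are obtained by evaluation from one list of
handleslides with Laurent polynomials as coefficients. -/
def IsLaurentFamily (V : MCS F D pts → List (Handleslide F)) : Prop :=
  ∃ S : List (Handleslide (LaurentPoly F ρ.Switches (ρ.FreeEvents μ m))),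
    ∀ (C : MCS F D pts) (hC : C.IsSRForm ρ μ m), V C = S.map (Handleslide.map hC.eval)

variable {pts ρ μ m}

/-- Past a crossing the differentials remain standard.  The coefficients of the companion
handleslides are Laurent polynomials since the ones of the disks are units. -/
theorem HasLaurentStdDiff.crossing {l k : ℕ} (h : D.events[l]? = some (.crossing k))
    {c : ℕ → LaurentPoly F ρ.Switches (ρ.FreeEvents μ m)}
    (hc : HasLaurentStdDiff pts ρ μ m F l c) :
    (∃ c', HasLaurentStdDiff pts ρ μ m F (l + 1) c') ∧
      IsLaurentFamily (F := F) pts ρ μ m fun C => C.postSlides ρ μ m l := by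
  obtain ⟨hu, hd⟩ := hc
  choose ci hci using fun i => (hu i).exists_right_inv
  have hinv : ∀ (C : MCS F D pts) (hC : C.IsSRForm ρ μ m),
      (fun i => (hC.eval (c i))⁻¹) = fun i => hC.eval (ci i) := fun C hC => funext fun i =>
    (eq_inv_of_mul_eq_one_right (by rw [← map_mul, hci, map_one])).symm
  by_cases hs : ρ.IsSwitch l
  · refine ⟨⟨switchCoeff (ρ.inv l) k (LaurentPoly.unitVar F _ ⟨l, hs⟩ 1)
      (LaurentPoly.unitVar F _ ⟨l, hs⟩ (-1)) c,
      isUnit_switchCoeff _ _ (LaurentPoly.isUnit_unitVar _ _) (LaurentPoly.isUnit_unitVar _ _) hu,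
      fun C hC => ?_⟩,
      ⟨k, k + 1, -LaurentPoly.unitVar F _ ⟨l, hs⟩ (-1)⟩ ::
        switchCompanion (ρ.inv l) k c ci (LaurentPoly.unitVar F _ ⟨l, hs⟩ (-1)), fun C hC => ?_⟩
    · rw [hC.midDiff_switch h hs (fun i => hC.eval_ne_zero (hu i)) (hd C hC)]
      congr 1
      funext i
      rw [map_switchCoeff, hC.eval_unitVar, hC.eval_unitVar, zpow_one, zpow_neg_one]
    · beta_reduce
      rw [hC.postSlides_switch h hs (hd C hC), List.map_cons, map_switchCompanion, hC.eval_unitVar,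
        zpow_neg_one, hinv C hC]
      simp [Handleslide.map, hC.eval_unitVar]
  · have hu' : ∀ i, IsUnit (c (Equiv.swap k (k + 1) i)) := fun i => hu _
    by_cases hr : ρ.IsGradedReturn μ m l
    · have hf : ρ.IsFree μ m l := Or.inl hr
      refine ⟨⟨fun i => c (Equiv.swap k (k + 1) i), hu', fun C hC => ?_⟩,
        returnCompanion (ρ.inv l) k c ci (LaurentPoly.freeVar F _ ⟨l, hf⟩), fun C hC => ?_⟩
      · rw [hC.midDiff_return h hr (fun i => hC.eval_ne_zero (hu i)) (hd C hC)]
      beta_reduce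
      rw [hC.postSlides_return h hr (hd C hC), map_returnCompanion, hC.eval_freeVar, hinv C hC]
    · refine ⟨⟨fun i => c (Equiv.swap k (k + 1) i), hu', fun C hC => ?_⟩, [],
        fun C _ => MCS.IsSRForm.postSlides_eq_nil h hs hr⟩
      rw [hC.midDiff_departure h hs hr (hd C hC)]

variable (pts ρ μ m)

/-- Left of all right cusps the differentials are standard, starting from the simple left cusps. -/
theorem exists_hasLaurentStdDiff (F : Type*) [Field F] (l : ℕ) (hl : l ≤ D.events.length)
    (hright : ∀ l' < l, ∀ k, D.events[l']? ≠ some (.rightCusp k)) :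
    ∃ c, HasLaurentStdDiff pts ρ μ m F l c := by
  induction l with
  | zero =>
    refine ⟨fun _ => 1, fun _ => isUnit_one, fun C hC => end_ext_stdE fun i => ?_⟩
    rw [stdDiff_of_le (by simp [strands_zero])]
    ext j
    exact (hC.midDiff_tri (Nat.zero_le _)).entry_eq_zero (by simp [strands_zero])
  | succ l ih =>
    obtain ⟨c, hc⟩ := ih (by omega) fun l' hl' => hright l' (by omega)
    have he := List.getElem?_eq_getElem (l := D.events) (i := l) (by omega)
    generalize D.events[l] = e at he
    cases e with
    | leftCusp k =>
      refine ⟨fun i => if i < k then c i else if i = k then 1 else c (i - 2), fun i => ?_,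
        fun C hC => ?_⟩
      · beta_reduce
        split_ifs
        · exact hc.1 i
        · exact isUnit_one
        · exact hc.1 _
      · rw [hC.midDiff_leftCusp he (hc.2 C hC)]
        congr 1
        funext i
        beta_reduce
        split_ifs <;> simp
    | crossing k => exact (hc.crossing he).1
    | rightCusp k => exact absurd he (hright l (by omega) k)

theorem isLaurentFamily_nil : IsLaurentFamily (F := F) pts ρ μ m fun _ => [] :=
  ⟨[], fun _ _ => rfl⟩

theorem isLaurentFamily_postSlides (hD : D.IsNearlyPlat) (l : ℕ) :
    IsLaurentFamily (F := F) pts ρ μ m fun C => C.postSlides ρ μ m l := by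
  by_cases h : ∃ k, D.events[l]? = some (.crossing k)
  · obtain ⟨k, hk⟩ := h
    obtain ⟨b, hb1, hb2, -⟩ := hD.exists_rightPart
    obtain ⟨c, hc⟩ := exists_hasLaurentStdDiff pts ρ μ m F l (lt_length_of_event hk).le
      fun l' hl' k' h' => by
        obtain ⟨p, hp⟩ := hb1 l _ hk ((hb2 l' k' h').trans hl'.le)
        cases hp
    exact (hc.crossing hk).2
  · have : (fun C : MCS F D pts => C.postSlides ρ μ m l) = fun _ => [] := by
      funext C
      unfold MCS.postSlides
      split
      · exact absurd ⟨_, by assumption⟩ h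
      · rfl
    rw [this]
    exact isLaurentFamily_nil pts ρ μ m

theorem isLaurentFamily_preSlides (l : ℕ) :
    IsLaurentFamily (F := F) pts ρ μ m fun C => C.preSlides ρ μ m l := by
  rcases he : D.events[l]? with _ | (k | k | k)
  · exact ⟨[], fun C _ => by simp [MCS.preSlides, he]⟩
  · exact ⟨[], fun C _ => by simp [MCS.preSlides, he]⟩
  · by_cases hs : ρ.IsSwitch l
    · refine ⟨[⟨k, k + 1, LaurentPoly.unitVar F _ ⟨l, hs⟩ 1⟩], fun C hC => ?_⟩
      simp [MCS.preSlides, he, hs, Handleslide.map, hC.eval_unitVar]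
    · by_cases hr : ρ.IsGradedReturn μ m l
      · have hf : ρ.IsFree μ m l := Or.inl hr
        refine ⟨[⟨k, k + 1, LaurentPoly.freeVar F _ ⟨l, hf⟩⟩], fun C hC => ?_⟩
        simp [MCS.preSlides, he, hr, Handleslide.map, hC.eval_freeVar]
      · exact ⟨[], fun C _ => by simp [MCS.preSlides, he, hs, hr]⟩
  · by_cases hm : m = 1
    · have hf : ρ.IsFree μ m l := Or.inr ⟨hm, k, he⟩
      refine ⟨[⟨k, k + 1, LaurentPoly.freeVar F _ ⟨l, hf⟩⟩], fun C hC => ?_⟩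
      simp [MCS.preSlides, he, hm, Handleslide.map, hC.eval_freeVar]
    · exact ⟨[], fun C _ => by simp [MCS.preSlides, he, hm]⟩

theorem exists_eval_eq_preCoeff (k l : ℕ) :
    ∃ g : LaurentPoly F ρ.Switches (ρ.FreeEvents μ m),
      ∀ (C : MCS F D pts) (hC : C.IsSRForm ρ μ m), C.preCoeff ρ μ m k l = hC.eval g := by
  obtain ⟨S, hS⟩ := isLaurentFamily_preSlides (F := F) pts ρ μ m l
  beta_reduce at hS
  exact ⟨slideCoeff k (k + 1) S, fun C hC => by rw [MCS.preCoeff, hS C hC, map_slideCoeff]⟩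

theorem isLaurentFamily_phiCollection (hD : D.IsNearlyPlat) (l : ℕ) :
    IsLaurentFamily (F := F) pts ρ μ m fun C => C.phiCollection ρ μ m l := by
  induction l with
  | zero => exact isLaurentFamily_nil pts ρ μ m
  | succ l ih =>
    obtain ⟨S, hS⟩ := ih
    rcases he : D.events[l]? with _ | (k | k | k)
    · exact ⟨[], fun C _ => by simp [MCS.phiCollection, he]⟩
    · exact ⟨[], fun C _ => by simp [MCS.phiCollection, he]⟩
    · by_cases hg : D.IsGradedCrossing μ m l
      · obtain ⟨P, hP⟩ := isLaurentFamily_postSlides (F := F) pts ρ μ m hD l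
        obtain ⟨g, hg'⟩ := exists_eval_eq_preCoeff (F := F) pts ρ μ m k l
        refine ⟨P.foldl (fun V h => incorporate h V) (passCrossing k (removeSlide k (k + 1)
          (incorporate ⟨k, k + 1, g⟩ S))), fun C hC => ?_⟩
        rw [map_foldl_incorporate, map_passCrossing, map_removeSlide, map_incorporate,
          ← hP C hC, ← hS C hC]
        simp [MCS.phiCollection, he, hg, hg' C hC, Handleslide.map]
      · refine ⟨passCrossing k S, fun C hC => ?_⟩
        rw [map_passCrossing, ← hS C hC]
        simp [MCS.phiCollection, he, hg]
    · refine ⟨passRightCusp k S, fun C hC => ?_⟩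
      rw [map_passRightCusp, ← hS C hC]
      simp [MCS.phiCollection, he]

/-- The handleslides of `Φ(C)` are Laurent polynomials. -/
theorem isLaurentFamily_phiSlides (hD : D.IsNearlyPlat) (l : ℕ) :
    IsLaurentFamily (F := F) pts ρ μ m fun C => C.phiSlides ρ μ m l := by
  obtain ⟨S, hS⟩ := isLaurentFamily_phiCollection (F := F) pts ρ μ m hD l
  rcases he : D.events[l]? with _ | (k | k | k)
  · exact ⟨[], fun C _ => by simp [MCS.phiSlides, he]⟩
  · exact ⟨[], fun C _ => by simp [MCS.phiSlides, he]⟩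
  · by_cases hg : D.IsGradedCrossing μ m l
    · obtain ⟨g, hg'⟩ := exists_eval_eq_preCoeff (F := F) pts ρ μ m k l
      refine ⟨[⟨k, k + 1, slideCoeff k (k + 1) (incorporate ⟨k, k + 1, g⟩ S)⟩], fun C hC => ?_⟩
      simp [MCS.phiSlides, he, hg, Handleslide.map, map_slideCoeff, map_incorporate, hS C hC,
        hg' C hC]
    · exact ⟨[], fun C _ => by simp [MCS.phiSlides, he, hg]⟩
  · by_cases hm : m = 1
    · obtain ⟨g, hg'⟩ := exists_eval_eq_preCoeff (F := F) pts ρ μ m k l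
      refine ⟨[⟨k, k + 1, slideCoeff k (k + 1) S + g⟩], fun C hC => ?_⟩
      rw [List.map_singleton, Handleslide.map, map_add, map_slideCoeff, ← hS C hC, ← hg' C hC]
      simp [MCS.phiSlides, he, hm]
    · exact ⟨[], fun C _ => by simp [MCS.phiSlides, he, hm]⟩

/-- The coefficient of `Φ(C)` at an event is a Laurent polynomial. -/
theorem exists_eval_eq_leftCoeff (hD : D.IsNearlyPlat) {i : ℕ} (hi : i ≤ D.events.length) :
    ∃ g : LaurentPoly F ρ.Switches (ρ.FreeEvents μ m),
      ∀ (C : MCS F D pts) (hC : C.IsSRForm ρ μ m) (A : MCS F D pts), C.IsPhi ρ μ m A →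
        A.leftCoeff i = hC.eval g := by
  obtain ⟨S, hS⟩ := isLaurentFamily_phiSlides (F := F) pts ρ μ m hD i
  beta_reduce at hS
  refine ⟨match S.getLast? with | some h => h.coeff | none => 0, fun C hC A hA => ?_⟩
  rw [MCS.leftCoeff, hA.2 i hi, hS C hC, List.getLast?_map]
  cases S.getLast? with
  | none => exact (map_zero _).symm
  | some h => rfl

end Laurent

theorem proposition6p2 {F : Type*} [Field F] (D : FrontDiagram) (hD : D.IsNearlyPlat)
    (pts : D.MarkedPoints) (o : D.Orientation) (μ : D.MaslovPotential o.twoRot)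
    (m : ℕ) (hm : m ∣ o.twoRot) (ρ : NormalRuling D) (hρ : ρ.IsGraded μ m) :
    (∀ C : MCS F D pts, C.IsSRForm ρ μ m → ∃ A : MCS F D pts, C.IsPhi ρ μ m A) ∧
    ∀ i : ℕ, (∃ k, D.events[i]? = some (.crossing k) ∨ D.events[i]? = some (.rightCusp k)) →
      ∃ g : LaurentPoly F ρ.Switches (ρ.FreeEvents μ m),
        ∀ C : MCS F D pts, C.IsSRForm ρ μ m → ∀ A : MCS F D pts, C.IsPhi ρ μ m A →
          A.leftCoeff i = g.eval (fun s => C.leftCoeff s.1) (fun t => C.leftCoeff t.1) := by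
  refine ⟨fun C hC => MCS.exists_isPhi hD hm hρ hC, fun i hi => ?_⟩
  have hlen : i ≤ D.events.length := by
    obtain ⟨k, h | h⟩ := hi <;> exact (lt_length_of_event h).le
  obtain ⟨g, hg⟩ := exists_eval_eq_leftCoeff (F := F) pts ρ μ m hD hlen
  exact ⟨g, fun C hC A hA => by rw [hg C hC A hA, hC.eval_apply]⟩
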